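/- Consider quantum algorithms in the following uniform model. A program is a fixed finite text, the same for all inputs, for a random access machine whose classical cells are words of $w=\Theta(\log n)$ bits and which has a constant number of quantum registers of $w$ qubits each, initially $|0\rangle$. Every operation has unit cost. The classical operations are arithmetic, comparison and branching on words and reading or writing a cell of an array. The quantum operations are the gates $H$, $T$, NOT, CNOT and Toffoli, the measurement of a qubit, a read of a classical array at an address in superposition, and a query to the input graph $G=(V,E)$, $V=\{1,\dots,n\}$, $m=|E|$, in superposition. In the adjacency matrix model a query $(i,j)$ returns the entry $A_{i,j}$ of the adjacency matrix. In the adjacency list model the degrees $d(1),\dots,d(n)$ are given in an array, and a query $(i,j)$ with $1\le j\le d(i)$ returns the $j$-th neighbour of $i$, where the neighbours of each vertex are listed in an arbitrary order. The quantum time of a run is the number of quantum operations that it executes. There are a quantum algorithm in the adjacency matrix model, a quantum algorithm in the adjacency list model, and a constant $C>0$ such that for every $n\ge 2$ and every undirected simple graph $G$ with $n$ vertices and $m$ edges, given in the respective model (in the list model, for every ordering of the neighbours), every run of the algorithm that has nonzero probability halts, and with probability at least $1-1/n$ the output is a maximal independent set of $G$, that is, an independent set that is contained in no other independent set. Moreover: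 (i) in the adjacency matrix model, the quantum time of every such run is at most $C\,n^{1.5}\log^2 n$, and so is the number of all its operations, classical ones included; (ii) in the adjacency list model, the quantum time of every such run is at most $C\sqrt{nm}\,\log^2 n$, and the number of all its operations, classical ones included, is at most $C\,(n+\sqrt{nm})\log^2 n$. -/

import Mathlib

/-!
A word RAM with quantum registers.

The machine has classical registers `R[0], R[1], …`, classical arrays `A_0, A_1, …`, and finitely
many quantum registers.  Every classical cell holds a word of `w` bits and every quantum register
consists of `w` qubits, where `w` is a constant multiple of the bit length of the number `n` of
vertices.  The arrays can also be read in superposition, and the input graph is accessed through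
an oracle.  A program is a fixed finite text, the same for all inputs; each elementary operation
has unit cost.
-/

noncomputable section

namespace QRam

/-- Arithmetic and comparison operations of the classical part. -/
inductive BinOp where
  | add | sub | mul | div | lt | eq

/-- The value of an operation, before reduction to a `w`-bit word. -/
def BinOp.eval : BinOp → ℕ → ℕ → ℕ
  | .add, a, b => a + b
  | .sub, a, b => a - b
  | .mul, a, b => a * b
  | .div, a, b => a / b
  | .lt, a, b => if a < b then 1 else 0
  | .eq, a, b => if a = b then 1 else 0

/-- Programs of a machine with `k` quantum registers.  Numbers `x y z : ℕ` name classical registers,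
`a : ℕ` names a classical array, and `r s t : Fin k` name quantum registers.  A qubit is addressed
by a quantum register together with a classical register that holds its position. -/
inductive Prog (k : ℕ) : Type where
  /-- `R[x] := c`. -/
  | const (x c : ℕ)
  /-- `R[x] := R[y] ∘ R[z]`. -/
  | op (o : BinOp) (x y z : ℕ)
  /-- `R[x] := A_a[R[y]]`. -/
  | load (x a y : ℕ)
  /-- `A_a[R[x]] := R[y]`. -/
  | store (a x y : ℕ)
  /-- First `p`, then `q`. -/
  | seq (p q : Prog k)
  /-- If `R[x] ≠ 0` then `p` else `q`. -/
  | ite (x : ℕ) (p q : Prog k)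
  /-- While `R[x] ≠ 0` do `p`. -/
  | loop (x : ℕ) (p : Prog k)
  /-- Hadamard gate on qubit `R[x]` of `r`. -/
  | had (r : Fin k) (x : ℕ)
  /-- The gate `diag(1, e^{iπ/4})` on qubit `R[x]` of `r`. -/
  | tgate (r : Fin k) (x : ℕ)
  /-- NOT gate on qubit `R[x]` of `r`. -/
  | xgate (r : Fin k) (x : ℕ)
  /-- Controlled NOT with control (`s`, `R[y]`) and target (`r`, `R[x]`). -/
  | cnot (s : Fin k) (y : ℕ) (r : Fin k) (x : ℕ)
  /-- Toffoli gate with controls (`s`, `R[y]`), (`t`, `R[z]`) and target (`r`, `R[x]`). -/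
  | ccnot (s : Fin k) (y : ℕ) (t : Fin k) (z : ℕ) (r : Fin k) (x : ℕ)
  /-- `R[y] :=` the outcome of measuring qubit `R[x]` of `r` in the computational basis. -/
  | meas (y : ℕ) (r : Fin k) (x : ℕ)
  /-- Input query `|i⟩_s |j⟩_t |b⟩_r ↦ |i⟩_s |j⟩_t |b ⊕ O(i, j)⟩_r`. -/
  | query (s t r : Fin k)
  /-- Quantum read of array `a`: `|i⟩_s |b⟩_r ↦ |i⟩_s |b ⊕ A_a[i]⟩_r`. -/
  | lookup (a : ℕ) (s r : Fin k)

/-- Computational basis states of `k` quantum registers of `w` qubits each. -/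
abbrev Basis (k w : ℕ) : Type := Fin k → Fin w → Bool

/-- (Unnormalised) state vectors. -/
abbrev QState (k w : ℕ) : Type := Basis k w → ℂ

variable {k w : ℕ}

/-- The squared norm of a state vector. -/
def normSq (ψ : QState k w) : ℝ := ∑ b, ‖ψ b‖ ^ 2

/-- The basis state in which all qubits are `0`. -/
def zeroState : QState k w := fun b => if b = (fun _ _ => false) then 1 else 0

/-- The number that a register holds in a basis state (least significant bit first). -/
def regVal (b : Basis k w) (r : Fin k) : ℕ := Nat.ofBits (b r)

/-- Replace the value of one qubit. -/
def setBit (b : Basis k w) (r : Fin k) (i : Fin w) (v : Bool) : Basis k w :=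
  Function.update b r (Function.update (b r) i v)

/-- Bitwise addition of the word `a` to a register. -/
def xorReg (b : Basis k w) (r : Fin k) (a : ℕ) : Basis k w :=
  Function.update b r (fun i => xor (b r i) (a.testBit i))

def applyHad (r : Fin k) (i : Fin w) (ψ : QState k w) : QState k w := fun b =>
  (ψ (setBit b r i false) + (if b r i then -1 else 1) * ψ (setBit b r i true)) / (Real.sqrt 2 : ℂ)

def applyT (r : Fin k) (i : Fin w) (ψ : QState k w) : QState k w := fun b =>
  (if b r i then Complex.exp (Complex.I * (Real.pi / 4 : ℝ)) else 1) * ψ b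

/-- NOT on qubit `(r, i)` controlled by a condition `f`; unitary as soon as `f` does not depend
on the qubit `(r, i)`. -/
def applyFlip (f : Basis k w → Bool) (r : Fin k) (i : Fin w) (ψ : QState k w) : QState k w :=
  fun b => ψ (setBit b r i (xor (b r i) (f b)))

/-- `|b⟩ ↦ |b with register r changed to (b r) ⊕ (f b)⟩`; unitary as soon as `f` does not depend on
register `r`. -/
def applyXor (f : Basis k w → ℕ) (r : Fin k) (ψ : QState k w) : QState k w :=
  fun b => ψ (xorReg b r (f b))

/-- The unnormalised state after outcome `v` of a measurement of qubit `(r, i)`; its squared norm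
is the probability of this outcome. -/
def project (r : Fin k) (i : Fin w) (v : Bool) (ψ : QState k w) : QState k w :=
  fun b => if b r i = v then ψ b else 0

/-- A configuration: what remains to be executed, the classical registers, the arrays, the
unnormalised quantum state, the number `time` of operations (classical or quantum) and the number
`qtime` of quantum operations executed so far. -/
structure Cfg (k w : ℕ) where
  todo : List (Prog k)
  reg : ℕ → ℕ
  arr : ℕ → ℕ → ℕ
  psi : QState k w
  time : ℕ
  qtime : ℕ

/-- Write the word `v mod 2^w` to register `x`. -/
def Cfg.setReg (c : Cfg k w) (x v : ℕ) : Cfg k w :=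
  { c with reg := Function.update c.reg x (v % 2 ^ w) }

/-- Continue with `l` after one classical operation. -/
def Cfg.classical (c : Cfg k w) (l : List (Prog k)) : Cfg k w :=
  { c with todo := l, time := c.time + 1 }

/-- Continue with `l` after one quantum operation that results in the state `ψ`. -/
def Cfg.quantum (c : Cfg k w) (l : List (Prog k)) (ψ : QState k w) : Cfg k w :=
  { c with todo := l, psi := ψ, time := c.time + 1, qtime := c.qtime + 1 }

/-- The possible successors of a configuration: two after a measurement, otherwise one.  Gates with
a position outside the register or with coinciding qubits, and queries whose target is one of
their address registers, leave the quantum state unchanged; a measurement at a position outside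
the register returns `0`. -/
def step (O : ℕ → ℕ → ℕ) (c : Cfg k w) : List (Cfg k w) :=
  match c.todo with
  | [] => [c]
  | .const x v :: l => [(c.classical l).setReg x v]
  | .op o x y z :: l => [(c.classical l).setReg x (o.eval (c.reg y) (c.reg z))]
  | .load x a y :: l => [(c.classical l).setReg x (c.arr a (c.reg y))]
  | .store a x y :: l =>
      [{ c.classical l with
          arr := Function.update c.arr a (Function.update (c.arr a) (c.reg x) (c.reg y)) }]
  | .seq p q :: l => [{ c with todo := p :: q :: l }]
  | .ite x p q :: l => [c.classical (if c.reg x ≠ 0 then p :: l else q :: l)]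
  | .loop x p :: l => [c.classical (if c.reg x ≠ 0 then p :: .loop x p :: l else l)]
  | .had r x :: l =>
      [c.quantum l (if h : c.reg x < w then applyHad r ⟨c.reg x, h⟩ c.psi else c.psi)]
  | .tgate r x :: l =>
      [c.quantum l (if h : c.reg x < w then applyT r ⟨c.reg x, h⟩ c.psi else c.psi)]
  | .xgate r x :: l =>
      [c.quantum l
        (if h : c.reg x < w then applyFlip (fun _ => true) r ⟨c.reg x, h⟩ c.psi else c.psi)]
  | .cnot s y r x :: l =>
      [c.quantum l
        (if h : c.reg y < w ∧ c.reg x < w ∧ (s, c.reg y) ≠ (r, c.reg x) then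
          applyFlip (fun b => b s ⟨c.reg y, h.1⟩) r ⟨c.reg x, h.2.1⟩ c.psi
        else c.psi)]
  | .ccnot s y t z r x :: l =>
      [c.quantum l
        (if h : c.reg y < w ∧ c.reg z < w ∧ c.reg x < w ∧ (s, c.reg y) ≠ (t, c.reg z) ∧
            (s, c.reg y) ≠ (r, c.reg x) ∧ (t, c.reg z) ≠ (r, c.reg x) then
          applyFlip (fun b => b s ⟨c.reg y, h.1⟩ && b t ⟨c.reg z, h.2.1⟩) r
            ⟨c.reg x, h.2.2.1⟩ c.psi
        else c.psi)]
  | .meas y r x :: l =>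
      if h : c.reg x < w then
        [(c.quantum l (project r ⟨c.reg x, h⟩ false c.psi)).setReg y 0,
          (c.quantum l (project r ⟨c.reg x, h⟩ true c.psi)).setReg y 1]
      else [(c.quantum l c.psi).setReg y 0]
  | .query s t r :: l =>
      [c.quantum l
        (if s ≠ r ∧ t ≠ r then
          applyXor (fun b => O (regVal b s) (regVal b t)) r c.psi
        else c.psi)]
  | .lookup a s r :: l =>
      [c.quantum l
        (if s ≠ r then applyXor (fun b => c.arr a (regVal b s)) r c.psi else c.psi)]

/-- All configurations after `N` steps, one for each sequence of measurement outcomes. -/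
def runs (O : ℕ → ℕ → ℕ) : ℕ → Cfg k w → List (Cfg k w)
  | 0, c => [c]
  | N + 1, c => (step O c).flatMap (runs O N)

/-- A quantum algorithm: a program together with the number of quantum registers and the
constant `wordFactor` in the word length. -/
structure Algorithm where
  numRegs : ℕ
  wordFactor : ℕ
  wordFactor_pos : 0 < wordFactor
  code : Prog numRegs

/-- The word length of an algorithm on graphs with `n` vertices. -/
def Algorithm.wordLength (P : Algorithm) (n : ℕ) : ℕ := P.wordFactor * Nat.size n

/-- How a graph is presented: the oracle for input queries, and data that are written to the array
`A_0` in advance. -/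
structure Input where
  oracle : ℕ → ℕ → ℕ
  given : ℕ → ℕ

/-- The initial configuration: `R[0] = n`, array `A_0` holds the given data, all other classical
cells are `0`, and all qubits are in state `|0⟩`. -/
def Algorithm.start (P : Algorithm) (n : ℕ) (I : Input) : Cfg P.numRegs (P.wordLength n) where
  todo := [P.code]
  reg := Function.update (fun _ => 0) 0 n
  arr := Function.update (fun _ _ => 0) 0 I.given
  psi := zeroState
  time := 0
  qtime := 0

/-- The vertex set that a configuration presents as output.  The vertex `v : Fin n` has the number
`v + 1`, and it belongs to the output if and only if `A_1[v + 1] ≠ 0`. -/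
def Cfg.output (n : ℕ) (c : Cfg k w) : Set (Fin n) := {v | c.arr 1 (v + 1) ≠ 0}

open Classical in
/-- On input `I` with `n` vertices, every run of `P` that has nonzero probability halts after at
most `t` operations, at most `q` of which are quantum operations, and with probability at least
`p` the output has the property `good`. -/
def Algorithm.Solves (P : Algorithm) (n : ℕ) (I : Input) (good : Set (Fin n) → Prop)
    (p t q : ℝ) : Prop :=
  ∃ N : ℕ,
    (∀ c ∈ runs I.oracle N (P.start n I), c.psi ≠ 0 →
      c.todo = [] ∧ (c.time : ℝ) ≤ t ∧ (c.qtime : ℝ) ≤ q) ∧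
    p ≤ ((runs I.oracle N (P.start n I)).map
      fun c => if good (c.output n) then normSq c.psi else 0).sum

open Classical in
/-- Adjacency matrix model: vertices are numbered `1, …, n`, and the query `(i, j)` returns the
entry `A_{i,j}`, extended by zero. -/
def matrixInput {n : ℕ} (G : SimpleGraph (Fin n)) : Input where
  oracle := fun i j =>
    if ∃ u v : Fin n, i = u + 1 ∧ j = v + 1 ∧ G.Adj u v then 1 else 0
  given := fun _ => 0

/-- An adjacency list representation of `G`: for each vertex `v` an enumeration, in any order,
of its neighbours. -/
abbrev AdjList {n : ℕ} (G : SimpleGraph (Fin n)) [DecidableRel G.Adj] : Type :=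
  (v : Fin n) → Fin (G.degree v) ≃ G.neighborSet v

/-- Adjacency list model: vertices are numbered `1, …, n`, the degrees are given, and the query
`(i, j)` with `1 ≤ j ≤ d(i)` returns the number of the `j`-th neighbour of `i`; all other queries
return `0`. -/
def listInput {n : ℕ} {G : SimpleGraph (Fin n)} [DecidableRel G.Adj] (L : AdjList G) : Input where
  oracle := fun i j =>
    if hi : 1 ≤ i ∧ i - 1 < n then
      if hj : 1 ≤ j ∧ j - 1 < G.degree ⟨i - 1, hi.2⟩ then
        (L ⟨i - 1, hi.2⟩ ⟨j - 1, hj.2⟩ : Fin n) + 1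
      else 0
    else 0
  given := fun i =>
    if hi : 1 ≤ i ∧ i - 1 < n then G.degree ⟨i - 1, hi.2⟩ else 0

end QRam

end

noncomputable section

namespace QRam

variable {k w : ℕ}

/-! ### A program logic -/

/-! The algorithm is the greedy one. The vertices are taken in descending order, and a vertex joins
the set `S` exactly when no neighbour of it has been found in `S`. If all decisions are right, the
final set is independent and every vertex outside has a neighbour inside, which is maximality
(`Partial.step`, `Partial.maximal`).

Each decision is a Grover search. In the matrix model it ranges over the `n` vertices: `A_1[x]`
holds `x` for `x` in `S` and `0` otherwise, and the matrix is queried at `A_1[x]`. In the list model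
it ranges over the positions in the list of the vertex: the neighbour is queried first and then
looked up in `A_1`. With `d` candidates the search space has size `4 ^ h`, where `2 * d < 4 ^ h ≤ 8
* d`, so at most half of it is marked. The number of marked elements is unknown, so the number of
iterations is drawn uniformly below `2 ^ h`; averaging `sin²` over it gives success probability at
least `1/4` (`sum_groverAmp_ge`). A final query verifies the result, so a reported neighbour always
exists. Repeating the trial `w` times leaves error at most `(3/4) ^ w`, and `w = 5 * Nat.size n`
makes this at most `1 / n ^ 2`; Bernoulli's inequality over `n` vertices gives `1 - 1 / n`
(`success_bound`).

A search costs `O(√d * w ^ 2)`: there are `w` trials of at most `2 ^ h` iterations, each with `O(w)`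
gates. Cauchy–Schwarz sums this to `√(n * ∑ d)` up to logarithms, with `∑ d = n ^ 2` or `2 * m`
(`sum_searchCost_le`). Vertices of degree zero are not searched, so the quantum time has no additive
term `n`.

Probabilities are handled by a program logic in which a real weight, a lower bound for the
probability of success still owed, travels along the unnormalised state and is divided at
measurements. After each trial all qubits are measured and reset, so between trials the quantum
state is a multiple `α • zeroState` and only `‖α‖ ^ 2` matters. A branch in which an error has
occurred carries weight at most `0`, and nothing but its running time has to be controlled further.
The bounds on time hold in every branch of nonzero amplitude. -/

/-- A configuration without the program text that remains to be executed. -/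
structure St (k w : ℕ) where
  reg : ℕ → ℕ
  arr : ℕ → ℕ → ℕ
  psi : QState k w
  time : ℕ
  qtime : ℕ

namespace St

def cfg (s : St k w) (l : List (Prog k)) : Cfg k w := ⟨l, s.reg, s.arr, s.psi, s.time, s.qtime⟩

/-- One classical operation without effect. -/
def tick (s : St k w) : St k w := { s with time := s.time + 1 }

/-- One classical operation that writes a word to a register. -/
def set (s : St k w) (x a : ℕ) : St k w :=
  { s with reg := Function.update s.reg x (a % 2 ^ w), time := s.time + 1 }

/-- One classical operation that writes a word to an array. -/
def put (s : St k w) (a x y : ℕ) : St k w :=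
  { s with
      arr := Function.update s.arr a (Function.update (s.arr a) x y), time := s.time + 1 }

/-- One quantum operation that results in the state `ψ`. -/
def quant (s : St k w) (ψ : QState k w) : St k w :=
  { s with psi := ψ, time := s.time + 1, qtime := s.qtime + 1 }

/-- One measurement with result `v` that results in the state `ψ`. -/
def measured (s : St k w) (y v : ℕ) (ψ : QState k w) : St k w :=
  { s with
      reg := Function.update s.reg y (v % 2 ^ w), psi := ψ, time := s.time + 1,
      qtime := s.qtime + 1 }

@[simp] theorem tick_reg (s : St k w) : s.tick.reg = s.reg := rfl
@[simp] theorem tick_arr (s : St k w) : s.tick.arr = s.arr := rfl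
@[simp] theorem tick_psi (s : St k w) : s.tick.psi = s.psi := rfl
@[simp] theorem tick_time (s : St k w) : s.tick.time = s.time + 1 := rfl
@[simp] theorem tick_qtime (s : St k w) : s.tick.qtime = s.qtime := rfl
theorem set_reg (s : St k w) (x a r : ℕ) :
    (s.set x a).reg r = if r = x then a % 2 ^ w else s.reg r := by
  simp [set, Function.update_apply]
@[simp] theorem set_arr (s : St k w) (x a : ℕ) : (s.set x a).arr = s.arr := rfl
@[simp] theorem set_psi (s : St k w) (x a : ℕ) : (s.set x a).psi = s.psi := rfl
@[simp] theorem set_time (s : St k w) (x a : ℕ) : (s.set x a).time = s.time + 1 := rfl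
@[simp] theorem set_qtime (s : St k w) (x a : ℕ) : (s.set x a).qtime = s.qtime := rfl
@[simp] theorem put_reg (s : St k w) (a x y : ℕ) : (s.put a x y).reg = s.reg := rfl
theorem put_arr (s : St k w) (a x y b z : ℕ) :
    (s.put a x y).arr b z = if b = a ∧ z = x then y else s.arr b z := by
  by_cases hb : b = a
  · subst hb
    simp [put, Function.update_apply]
  · simp [put, hb]
@[simp] theorem put_psi (s : St k w) (a x y : ℕ) : (s.put a x y).psi = s.psi := rfl
@[simp] theorem put_time (s : St k w) (a x y : ℕ) : (s.put a x y).time = s.time + 1 := rfl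
@[simp] theorem put_qtime (s : St k w) (a x y : ℕ) : (s.put a x y).qtime = s.qtime := rfl
@[simp] theorem quant_reg (s : St k w) (ψ : QState k w) : (s.quant ψ).reg = s.reg := rfl
@[simp] theorem quant_arr (s : St k w) (ψ : QState k w) : (s.quant ψ).arr = s.arr := rfl
@[simp] theorem quant_psi (s : St k w) (ψ : QState k w) : (s.quant ψ).psi = ψ := rfl
theorem measured_reg (s : St k w) (y v : ℕ) (ψ : QState k w) (r : ℕ) :
    (s.measured y v ψ).reg r = if r = y then v % 2 ^ w else s.reg r := by
  simp [measured, Function.update_apply]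
@[simp] theorem measured_psi (s : St k w) (y v : ℕ) (ψ : QState k w) :
    (s.measured y v ψ).psi = ψ := rfl

end St

/-- `Ok O l Φ c v`: the runs from `c` can be followed until only `l` remains to be executed, such
that each of them ends in a state `s` with `Φ s u` for a share `u` of the weight `v`; runs of
probability zero can be abandoned when they carry no weight. -/
inductive Ok (O : ℕ → ℕ → ℕ) (l : List (Prog k)) (Φ : St k w → ℝ → Prop) : Cfg k w → ℝ → Prop
  | done (s : St k w) (v : ℝ) : Φ s v → Ok O l Φ (s.cfg l) v
  | dead (c : Cfg k w) (v : ℝ) : c.psi = 0 → v ≤ 0 → Ok O l Φ c v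
  | one (c c' : Cfg k w) (v : ℝ) : step O c = [c'] → Ok O l Φ c' v → Ok O l Φ c v
  | two (c c₁ c₂ : Cfg k w) (v v₁ v₂ : ℝ) : step O c = [c₁, c₂] → v ≤ v₁ + v₂ →
      Ok O l Φ c₁ v₁ → Ok O l Φ c₂ v₂ → Ok O l Φ c v

theorem Ok.trans {O : ℕ → ℕ → ℕ} {l l' : List (Prog k)} {Φ Ψ : St k w → ℝ → Prop}
    {c : Cfg k w} {v : ℝ} (h : Ok O l Φ c v)
    (hΦ : ∀ s u, Φ s u → Ok O l' Ψ (s.cfg l) u) : Ok O l' Ψ c v := by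
  induction h with
  | done s v h => exact hΦ s v h
  | dead c v h hv => exact .dead c v h hv
  | one c c' v h _ ih => exact .one c c' v h ih
  | two c c₁ c₂ v v₁ v₂ h hv _ _ ih₁ ih₂ => exact .two c c₁ c₂ v v₁ v₂ h hv ih₁ ih₂

/-- Executing `p` in state `s` with weight `v` leads to states and weights that satisfy `Φ`. -/
def Wp (O : ℕ → ℕ → ℕ) (p : Prog k) (s : St k w) (v : ℝ) (Φ : St k w → ℝ → Prop) : Prop :=
  ∀ l, Ok O l Φ (s.cfg (p :: l)) v

section rules

variable {O : ℕ → ℕ → ℕ} {s : St k w} {v : ℝ} {Φ Ψ : St k w → ℝ → Prop}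

theorem Wp.mono {p : Prog k} (h : Wp O p s v Φ) (hΦ : ∀ s' v', Φ s' v' → Ψ s' v') :
    Wp O p s v Ψ :=
  fun l => (h l).trans fun s' v' h' => .done _ _ (hΦ s' v' h')

theorem wp_seq {p q : Prog k} (h : Wp O p s v fun s' v' => Wp O q s' v' Φ) :
    Wp O (.seq p q) s v Φ :=
  fun l => .one _ (s.cfg (p :: q :: l)) _ rfl ((h (q :: l)).trans fun _ _ h' => h' l)

theorem wp_const {x a : ℕ} (h : Φ (s.set x a) v) : Wp O (.const x a) s v Φ :=
  fun l => .one _ ((s.set x a).cfg l) _ rfl (.done _ _ h)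

theorem wp_op {o : BinOp} {x y z : ℕ} (h : Φ (s.set x (o.eval (s.reg y) (s.reg z))) v) :
    Wp O (.op o x y z) s v Φ :=
  fun l => .one _ ((s.set x _).cfg l) _ rfl (.done _ _ h)

theorem wp_load {x a y : ℕ} (h : Φ (s.set x (s.arr a (s.reg y))) v) :
    Wp O (.load x a y) s v Φ :=
  fun l => .one _ ((s.set x _).cfg l) _ rfl (.done _ _ h)

theorem wp_store {a x y : ℕ} (h : Φ (s.put a (s.reg x) (s.reg y)) v) :
    Wp O (.store a x y) s v Φ :=
  fun l => .one _ ((s.put a (s.reg x) (s.reg y)).cfg l) _ rfl (.done _ _ h)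

theorem wp_ite {x : ℕ} {p q : Prog k} (hp : s.reg x ≠ 0 → Wp O p s.tick v Φ)
    (hq : s.reg x = 0 → Wp O q s.tick v Φ) : Wp O (.ite x p q) s v Φ := by
  intro l
  by_cases hx : s.reg x = 0
  · exact .one _ (s.tick.cfg (q :: l)) _ (by simp [step, St.cfg, Cfg.classical, St.tick, hx])
      (hq hx l)
  · exact .one _ (s.tick.cfg (p :: l)) _ (by simp [step, St.cfg, Cfg.classical, St.tick, hx])
      (hp hx l)

/-- The variant `μ` makes this a total correctness rule. Running time is not treated separately: it
is a component of the state and is bounded within the invariant. Each test of the condition is an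
operation, hence the ticks. -/
theorem wp_loop {x : ℕ} {p : Prog k} (I : St k w → ℝ → Prop) (μ : St k w → ℕ)
    (h0 : ∀ s v, I s v → s.reg x = 0 → Φ s.tick v)
    (h1 : ∀ s v, I s v → s.reg x ≠ 0 →
      Wp O p s.tick v fun s' v' => I s' v' ∧ μ s' < μ s)
    (hI : I s v) : Wp O (.loop x p) s v Φ := by
  intro l
  induction hm : μ s using Nat.strong_induction_on generalizing s v with
  | _ m ih =>
    by_cases hx : s.reg x = 0
    · exact .one _ (s.tick.cfg l) _ (by simp [step, St.cfg, Cfg.classical, St.tick, hx])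
        (.done _ _ (h0 s v hI hx))
    · refine .one _ (s.tick.cfg (p :: .loop x p :: l)) _
        (by simp [step, St.cfg, Cfg.classical, St.tick, hx]) ?_
      exact (h1 s v hI hx _).trans fun s' v' h' => ih _ (hm ▸ h'.2) h'.1 rfl

theorem wp_had {r : Fin k} {x : ℕ}
    (h : Φ (s.quant (if h : s.reg x < w then applyHad r ⟨s.reg x, h⟩ s.psi else s.psi)) v) :
    Wp O (.had r x) s v Φ :=
  fun l => .one _ (St.cfg _ l) _ rfl (.done _ _ h)

theorem wp_tgate {r : Fin k} {x : ℕ} (hx : s.reg x < w)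
    (h : Φ (s.quant (applyT r ⟨s.reg x, hx⟩ s.psi)) v) : Wp O (.tgate r x) s v Φ := by
  refine fun l => .one _ (St.cfg _ l) _ ?_ (.done _ _ h)
  simp [step, St.cfg, St.quant, Cfg.quantum, hx]

theorem wp_xgate {r : Fin k} {x : ℕ} (hx : s.reg x < w)
    (h : Φ (s.quant (applyFlip (fun _ => true) r ⟨s.reg x, hx⟩ s.psi)) v) :
    Wp O (.xgate r x) s v Φ := by
  refine fun l => .one _ (St.cfg _ l) _ ?_ (.done _ _ h)
  simp [step, St.cfg, St.quant, Cfg.quantum, hx]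

theorem wp_query {a b r : Fin k} (har : a ≠ r) (hbr : b ≠ r)
    (h : Φ (s.quant (applyXor (fun b' => O (regVal b' a) (regVal b' b)) r s.psi)) v) :
    Wp O (.query a b r) s v Φ := by
  refine fun l => .one _ (St.cfg _ l) _ ?_ (.done _ _ h)
  simp [step, St.cfg, St.quant, Cfg.quantum, har, hbr]

theorem wp_lookup {a : ℕ} {t r : Fin k} (htr : t ≠ r)
    (h : Φ (s.quant (applyXor (fun b => s.arr a (regVal b t)) r s.psi)) v) :
    Wp O (.lookup a t r) s v Φ := by
  refine fun l => .one _ (St.cfg _ l) _ ?_ (.done _ _ h)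
  simp [step, St.cfg, St.quant, Cfg.quantum, htr]

/-- The weight may be divided freely between the outcomes. An outcome of amplitude zero need not
satisfy the postcondition if it receives no positive weight; this is how a search without marked
elements is shown never to report one. -/
theorem wp_meas {y : ℕ} {r : Fin k} {x : ℕ} (hx : s.reg x < w) (v₀ v₁ : ℝ) (hv : v ≤ v₀ + v₁)
    (h₀ : project r ⟨s.reg x, hx⟩ false s.psi = 0 ∧ v₀ ≤ 0 ∨
      Φ (s.measured y 0 (project r ⟨s.reg x, hx⟩ false s.psi)) v₀)
    (h₁ : project r ⟨s.reg x, hx⟩ true s.psi = 0 ∧ v₁ ≤ 0 ∨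
      Φ (s.measured y 1 (project r ⟨s.reg x, hx⟩ true s.psi)) v₁) :
    Wp O (.meas y r x) s v Φ := by
  refine fun l => .two _
    ((s.measured y 0 (project r ⟨s.reg x, hx⟩ false s.psi)).cfg l)
    ((s.measured y 1 (project r ⟨s.reg x, hx⟩ true s.psi)).cfg l) v v₀ v₁ ?_ hv ?_ ?_
  · simp [step, St.cfg, St.measured, Cfg.quantum, Cfg.setReg, hx]
  · exact h₀.elim (fun h => .dead _ _ h.1 h.2) (fun h => .done _ _ h)
  · exact h₁.elim (fun h => .dead _ _ h.1 h.2) (fun h => .done _ _ h)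

/-- A loop that counts register `x` down to zero, where register `u` holds `1`. -/
def Prog.down (x u : ℕ) (p : Prog k) : Prog k := .loop x (.seq (.op .sub x x u) p)

/-- The counter is decremented before the body runs, so the body sees the index `i` of the invariant
that it has to establish. The bound `i < 2 ^ w` ensures that writing `i` is not a truncation. -/
theorem wp_down {x u : ℕ} {p : Prog k} (I : ℕ → St k w → ℝ → Prop)
    (h0 : ∀ s v, I 0 s v → s.reg x = 0 → Φ s.tick v)
    (h1 : ∀ i s v, I (i + 1) s v → s.reg x = i + 1 → i < 2 ^ w →
      s.reg u = 1 ∧ Wp O p (s.tick.set x i) v fun s' v' => I i s' v' ∧ s'.reg x = i)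
    (hw : s.reg x < 2 ^ w)
    (hI : I (s.reg x) s v) : Wp O (.down x u p) s v Φ := by
  refine wp_loop (fun s v => s.reg x < 2 ^ w ∧ I (s.reg x) s v) (fun s => s.reg x) ?_ ?_ ⟨hw, hI⟩
  · intro s v h hx
    exact h0 s v (hx ▸ h.2) hx
  · intro s v ⟨hw, h⟩ hx
    obtain ⟨i, hi⟩ := Nat.exists_eq_succ_of_ne_zero hx
    obtain ⟨hu, hp⟩ := h1 i s v (by rw [hi] at h; exact h) hi (by omega)
    refine wp_seq (wp_op ?_)
    have he : BinOp.eval .sub (s.tick.reg x) (s.tick.reg u) = i := by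
      simp [BinOp.eval, hu, hi]
    rw [he]
    refine hp.mono fun s' v' ⟨h', hx'⟩ => ?_
    rw [hx']
    exact ⟨⟨by omega, h'⟩, by omega⟩

end rules

/-! ### Adequacy of the program logic -/

theorem normSq_nonneg (ψ : QState k w) : 0 ≤ normSq ψ :=
  Finset.sum_nonneg fun _ _ => by positivity

/-- All quantum operations are linear, so a branch of amplitude zero stays one. This justifies the
constructor `Ok.dead`. -/
theorem step_psi_zero {O : ℕ → ℕ → ℕ} {c : Cfg k w} (h : c.psi = 0) :
    ∀ c' ∈ step O c, c'.psi = 0 := by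
  have hH : ∀ (r : Fin k) (i : Fin w), applyHad r i (0 : QState k w) = 0 := fun r i => by
    funext b; simp [applyHad]
  have hT : ∀ (r : Fin k) (i : Fin w), applyT r i (0 : QState k w) = 0 := fun r i => by
    funext b; simp [applyT]
  have hF : ∀ f (r : Fin k) (i : Fin w), applyFlip f r i (0 : QState k w) = 0 := fun f r i => by
    funext b; simp [applyFlip]
  have hX : ∀ f (r : Fin k), applyXor f r (0 : QState k w) = 0 := fun f r => by
    funext b; simp [applyXor]
  have hP : ∀ (r : Fin k) (i : Fin w) v, project r i v (0 : QState k w) = 0 := fun r i v => by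
    funext b; simp [project]
  intro c' hc'
  obtain ⟨todo, reg, arr, psi, time, qtime⟩ := c
  obtain rfl : psi = 0 := h
  rcases todo with _ | ⟨p, l⟩
  · simp [step] at hc'
    simp [hc']
  · cases p <;>
      simp [step, Cfg.classical, Cfg.quantum, Cfg.setReg, hH, hT, hF, hX, hP] at hc' <;>
      first
        | (subst hc'; rfl)
        | (split_ifs at hc' <;> simp at hc' <;> rcases hc' with rfl | rfl <;> rfl)

theorem runs_psi_zero {O : ℕ → ℕ → ℕ} (N : ℕ) {c : Cfg k w} (h : c.psi = 0) :
    ∀ c' ∈ runs O N c, c'.psi = 0 := by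
  induction N generalizing c with
  | zero => simp [runs, h]
  | succ N ih =>
    intro c' hc'
    simp only [runs, List.mem_flatMap] at hc'
    obtain ⟨a, ha, hc'⟩ := hc'
    exact ih (step_psi_zero h a ha) c' hc'

theorem runs_halted {O : ℕ → ℕ → ℕ} (N : ℕ) {c : Cfg k w} (h : c.todo = []) :
    runs O N c = [c] := by
  induction N with
  | zero => rfl
  | succ N ih => simp [runs, step, h, ih]

/-- Adequacy of the logic, by induction on the finite tree of measurement outcomes. Branches halt at
different depths, so the claim is made for all sufficiently large `N`; halted configurations repeat
themselves, which allows the maximum of the two depths to be used at a measurement. Nonnegativity of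
`f` covers the abandoned branches. -/
theorem Ok.runs {O : ℕ → ℕ → ℕ} {Φ : St k w → ℝ → Prop} {c : Cfg k w} {v : ℝ}
    (h : Ok O [] Φ c v) {A : Cfg k w → Prop} {f : Cfg k w → ℝ} (hf : ∀ c, 0 ≤ f c)
    (hΦ : ∀ s v, Φ s v → A (s.cfg []) ∧ v ≤ f (s.cfg [])) :
    ∃ N₀, ∀ N, N₀ ≤ N → (∀ c' ∈ QRam.runs O N c, c'.psi ≠ 0 → c'.todo = [] ∧ A c') ∧
      v ≤ ((QRam.runs O N c).map f).sum := by
  induction h with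
  | done s v h =>
    refine ⟨0, fun N _ => ?_⟩
    rw [runs_halted N (c := s.cfg []) rfl]
    have := hΦ s v h
    simp only [List.mem_singleton, forall_eq, List.map_cons, List.map_nil, List.sum_singleton]
    exact ⟨fun _ => ⟨rfl, this.1⟩, this.2⟩
  | dead c v h hv =>
    refine ⟨0, fun N _ => ⟨fun c' hc' h' => absurd (runs_psi_zero N h c' hc') h', hv.trans ?_⟩⟩
    refine List.sum_nonneg fun x hx => ?_
    obtain ⟨a, _, rfl⟩ := List.mem_map.1 hx
    exact hf a
  | one c c' v h _ ih =>
    obtain ⟨N₀, ih⟩ := ih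
    refine ⟨N₀ + 1, fun N hN => ?_⟩
    obtain ⟨N, rfl⟩ : ∃ M, N = M + 1 := ⟨N - 1, by omega⟩
    simpa [QRam.runs, h] using ih N (by omega)
  | two c c₁ c₂ v v₁ v₂ h hv _ _ ih₁ ih₂ =>
    obtain ⟨N₁, ih₁⟩ := ih₁
    obtain ⟨N₂, ih₂⟩ := ih₂
    refine ⟨max N₁ N₂ + 1, fun N hN => ?_⟩
    obtain ⟨N, rfl⟩ : ∃ M, N = M + 1 := ⟨N - 1, by omega⟩
    have h₁ := ih₁ N (by omega)
    have h₂ := ih₂ N (by omega)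
    constructor
    · intro c' hc'
      simp only [QRam.runs, h, List.flatMap_cons, List.flatMap_nil, List.append_nil,
        List.mem_append] at hc'
      exact hc'.elim (h₁.1 c') (h₂.1 c')
    · simp only [QRam.runs, h, List.flatMap_cons, List.flatMap_nil, List.append_nil,
        List.map_append, List.sum_append]
      linarith [h₁.2, h₂.2]

/-! ### Basis states -/

theorem setBit_apply (b : Basis k w) (r : Fin k) (i : Fin w) (v : Bool) (r' : Fin k)
    (i' : Fin w) : setBit b r i v r' i' = if r' = r ∧ i' = i then v else b r' i' := by
  by_cases hr : r' = r
  · subst hr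
    by_cases hi : i' = i <;> simp [setBit, hi]
  · simp [setBit, hr]

theorem basis_ext {b b' : Basis k w} (h : ∀ r i, b r i = b' r i) : b = b' :=
  funext fun r => funext fun i => h r i

theorem setBit_setBit (b : Basis k w) (r : Fin k) (i : Fin w) (u v : Bool) :
    setBit (setBit b r i u) r i v = setBit b r i v :=
  basis_ext fun r' i' => by simp only [setBit_apply]; split_ifs <;> rfl

theorem setBit_comm (b : Basis k w) {r r' : Fin k} {i i' : Fin w} (h : (r, i) ≠ (r', i'))
    (u v : Bool) : setBit (setBit b r i u) r' i' v = setBit (setBit b r' i' v) r i u := by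
  refine basis_ext fun r'' i'' => ?_
  simp only [setBit_apply]
  split_ifs with h₁ h₂ h₂ <;> first | rfl | skip
  exact absurd (by rw [← h₂.1, ← h₂.2, ← h₁.1, ← h₁.2]) h

theorem setBit_eq_self (b : Basis k w) (r : Fin k) (i : Fin w) {v : Bool} (h : b r i = v) :
    setBit b r i v = b :=
  basis_ext fun r' i' => by
    rw [setBit_apply]
    split_ifs with h'
    · rw [h'.1, h'.2, h]
    · rfl

theorem xorReg_apply_self (b : Basis k w) (r : Fin k) (a : ℕ) (i : Fin w) :
    xorReg b r a r i = xor (b r i) (a.testBit i) := by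
  simp [xorReg]

theorem xorReg_apply_of_ne (b : Basis k w) {r r' : Fin k} (a : ℕ) (h : r' ≠ r) :
    xorReg b r a r' = b r' := by
  simp [xorReg, h]

theorem xorReg_xorReg (b : Basis k w) (r : Fin k) (a : ℕ) : xorReg (xorReg b r a) r a = b := by
  refine basis_ext fun r' i => ?_
  by_cases h : r' = r
  · subst h
    simp [xorReg_apply_self]
  · rw [xorReg_apply_of_ne _ _ h, xorReg_apply_of_ne _ _ h]

theorem regVal_xorReg_of_ne (b : Basis k w) {r r' : Fin k} (a : ℕ) (h : r' ≠ r) :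
    regVal (xorReg b r a) r' = regVal b r' := by
  rw [regVal, regVal, xorReg_apply_of_ne _ _ h]

theorem testBit_regVal (b : Basis k w) (r : Fin k) (i : Fin w) :
    (regVal b r).testBit i = b r i := by
  rw [regVal, Nat.testBit_ofBits_lt _ _ i.2]

theorem regVal_inj {b b' : Basis k w} {r : Fin k} (h : regVal b r = regVal b' r) :
    b r = b' r :=
  funext fun i => by rw [← testBit_regVal b, h, testBit_regVal]

theorem regVal_of_testBit {b : Basis k w} {r : Fin k} {a : ℕ} (ha : a < 2 ^ w)
    (h : ∀ i, b r i = a.testBit i) : regVal b r = a := by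
  refine Nat.eq_of_testBit_eq fun i => ?_
  by_cases hi : i < w
  · rw [show i = ((⟨i, hi⟩ : Fin w) : ℕ) from rfl, testBit_regVal, h]
  · rw [regVal, Nat.testBit_ofBits_ge _ _ (by omega), Nat.testBit_lt_two_pow]
    exact ha.trans_le (Nat.pow_le_pow_right (by norm_num) (by omega))

theorem regVal_zero {b : Basis k w} {r : Fin k} (h : ∀ i, b r i = false) : regVal b r = 0 :=
  regVal_of_testBit (by positivity) (by simpa using h)

theorem regVal_xorReg_self {b : Basis k w} {r : Fin k} {a : ℕ} (ha : a < 2 ^ w)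
    (h : ∀ i, b r i = false) : regVal (xorReg b r a) r = a :=
  regVal_of_testBit ha fun i => by simp [xorReg_apply_self, h]

/-- The state vector of a basis state. -/
def ket (b₀ : Basis k w) : QState k w := fun b => if b = b₀ then 1 else 0

theorem zeroState_eq_ket : (zeroState : QState k w) = ket fun _ _ => false := rfl

/-- `f` does not depend on the contents of register `r`. -/
def Indep (f : Basis k w → ℕ) (r : Fin k) : Prop := ∀ b a, f (xorReg b r a) = f b

theorem indep_one (F : ℕ → ℕ) {r x : Fin k} (h : x ≠ r) :
    Indep (fun b : Basis k w => F (regVal b x)) r :=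
  fun b a => by simp only [regVal_xorReg_of_ne b a h]

theorem indep_two (F : ℕ → ℕ → ℕ) {r x y : Fin k} (hx : x ≠ r) (hy : y ≠ r) :
    Indep (fun b : Basis k w => F (regVal b x) (regVal b y)) r :=
  fun b a => by simp only [regVal_xorReg_of_ne b a hx, regVal_xorReg_of_ne b a hy]

/-- The permutation of the basis states that `applyXor` performs. -/
def xorPerm (f : Basis k w → ℕ) (r : Fin k) (b : Basis k w) : Basis k w := xorReg b r (f b)

theorem xorPerm_involutive {f : Basis k w → ℕ} {r : Fin k} (h : Indep f r) :
    Function.Involutive (xorPerm f r) := fun b => by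
  rw [xorPerm, xorPerm, h, xorReg_xorReg]

theorem applyXor_ket {f : Basis k w → ℕ} {r : Fin k} (h : Indep f r) (c : ℂ)
    (b₀ : Basis k w) : applyXor f r (c • ket b₀) = c • ket (xorPerm f r b₀) := by
  funext b
  have : xorReg b r (f b) = b₀ ↔ b = xorPerm f r b₀ :=
    (xorPerm_involutive h).eq_iff
  simp only [applyXor, ket, Pi.smul_apply, this]

/-! ### Norms -/

theorem normSq_smul_ket (c : ℂ) (b₀ : Basis k w) : normSq (c • ket b₀) = ‖c‖ ^ 2 := by
  rw [normSq, Finset.sum_eq_single b₀]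
  · simp [ket]
  · intro b _ hb
    simp [ket, hb]
  · simp

theorem normSq_eq_zero {ψ : QState k w} (h : normSq ψ = 0) : ψ = 0 := by
  funext b
  have := (Finset.sum_eq_zero_iff_of_nonneg (fun b _ => by positivity)).1 h b (Finset.mem_univ b)
  simpa using this

theorem normSq_project_add (r : Fin k) (i : Fin w) (ψ : QState k w) :
    normSq (project r i false ψ) + normSq (project r i true ψ) = normSq ψ := by
  rw [normSq, normSq, normSq, ← Finset.sum_add_distrib]
  refine Finset.sum_congr rfl fun b _ => ?_
  cases h : b r i <;> simp [project, h]

theorem flip_involutive (r : Fin k) (i : Fin w) :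
    Function.Involutive fun b : Basis k w => setBit b r i (xor (b r i) true) := fun b => by
  simp only [setBit_setBit]
  exact setBit_eq_self _ _ _ (by simp [setBit_apply])

theorem normSq_flip (r : Fin k) (i : Fin w) (ψ : QState k w) :
    normSq (applyFlip (fun _ => true) r i ψ) = normSq ψ :=
  Equiv.sum_comp (flip_involutive r i).toPerm fun b => ‖ψ b‖ ^ 2

/-- In every basis state that occurs in `ψ`, qubit `(r, i)` is `0`. -/
def Clean (ψ : QState k w) (r : Fin k) (i : Fin w) : Prop := ∀ b, ψ b ≠ 0 → b r i = false

theorem Clean.project {ψ : QState k w} {r r' : Fin k} {i i' : Fin w} (h : Clean ψ r i)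
    (v : Bool) : Clean (project r' i' v ψ) r i := fun b hb => h b fun h0 => hb (by
  simp [QRam.project, h0])

theorem clean_project (ψ : QState k w) (r : Fin k) (i : Fin w) :
    Clean (project r i false ψ) r i := fun b hb => by
  by_contra h
  exact hb (by simp [project, h])

theorem Clean.flip {ψ : QState k w} {r r' : Fin k} {i i' : Fin w} (h : Clean ψ r i)
    (hne : (r, i) ≠ (r', i')) : Clean (applyFlip (fun _ => true) r' i' ψ) r i := fun b hb => by
  have := h _ hb
  rwa [setBit_apply, if_neg] at this
  rintro ⟨rfl, rfl⟩
  exact hne rfl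

theorem clean_flip_project (ψ : QState k w) (r : Fin k) (i : Fin w) :
    Clean (applyFlip (fun _ => true) r i (project r i true ψ)) r i := fun b hb => by
  by_contra h
  exact hb (by simp [applyFlip, project, setBit_apply, h])

/-- This is what makes resetting work: once every qubit is known to be `0`, a complex scalar is all
that remains of the quantum state. -/
theorem eq_zeroState_of_clean {ψ : QState k w} (h : ∀ r i, Clean ψ r i) :
    ψ = ψ (fun _ _ => false) • zeroState := by
  funext b
  by_cases hb : b = fun _ _ => false
  · simp [hb, zeroState]
  · by_cases h0 : ψ b = 0
    · simp [h0, zeroState, hb]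
    · exact absurd (basis_ext fun r i => h r i b h0) hb

/-! ### A fair coin -/

theorem sqrt_two_sq : (Real.sqrt 2 : ℂ) * Real.sqrt 2 = 2 := by
  rw [← Complex.ofReal_mul, Real.mul_self_sqrt (by norm_num)]; norm_num

theorem sqrt_two_ne_zero : (Real.sqrt 2 : ℂ) ≠ 0 := fun h => by
  have := sqrt_two_sq
  simp [h] at this

theorem norm_div_sqrt_two_sq (c : ℂ) : ‖c / (Real.sqrt 2 : ℂ)‖ ^ 2 = ‖c‖ ^ 2 / 2 := by
  rw [norm_div, div_pow, Complex.norm_real, Real.norm_eq_abs, sq_abs,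
    Real.sq_sqrt (by norm_num)]

theorem coin_false (r : Fin k) (i : Fin w) (c : ℂ) :
    project r i false (applyHad r i (c • zeroState)) = (c / (Real.sqrt 2 : ℂ)) • zeroState := by
  funext b
  by_cases hb : b = fun _ _ => false
  · subst hb
    have h1 : setBit (fun _ _ => false : Basis k w) r i false = fun _ _ => false :=
      setBit_eq_self _ _ _ rfl
    have h2 : setBit (fun _ _ => false : Basis k w) r i true ≠ fun _ _ => false := fun h => by
      have := congrFun (congrFun h r) i
      simp [setBit_apply] at this
    simp [project, applyHad, zeroState, h1, h2]
  · cases h : b r i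
    · have h1 : setBit b r i false ≠ fun _ _ => false := by rwa [setBit_eq_self _ _ _ h]
      have h2 : setBit b r i true ≠ fun _ _ => false := fun h => by
        have := congrFun (congrFun h r) i
        simp [setBit_apply] at this
      simp [project, applyHad, zeroState, h1, h2, hb]
    · simp [project, zeroState, hb, h]

/-- After the correction by a NOT gate, outcome `1` leaves the same state as outcome `0`, so a coin
toss only divides the scalar by `√2`. -/
theorem coin_true (r : Fin k) (i : Fin w) (c : ℂ) :
    applyFlip (fun _ => true) r i (project r i true (applyHad r i (c • zeroState))) =
      (c / (Real.sqrt 2 : ℂ)) • zeroState := by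
  funext b
  have h2 : setBit b r i true ≠ fun _ _ => false := fun h => by
    have := congrFun (congrFun h r) i
    simp [setBit_apply] at this
  cases h : b r i
  · have h1 : setBit b r i false = b := setBit_eq_self _ _ _ h
    simp [applyFlip, project, applyHad, zeroState, setBit_setBit, h, h1, h2, setBit_apply,
      ite_div]
  · have hb : b ≠ fun _ _ => false := fun h' => by simp [h'] at h
    simp [applyFlip, project, setBit_apply, h, zeroState, hb]

/-! ### Layers of Hadamard gates -/

/-- The Hadamard gate on qubit `(r, i)`, the identity if there is no such qubit. -/
def hadL (r : Fin k) (i : ℕ) : QState k w →ₗ[ℂ] QState k w where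
  toFun ψ := if h : i < w then applyHad r ⟨i, h⟩ ψ else ψ
  map_add' φ ψ := by
    split_ifs
    · funext b; simp only [applyHad, Pi.add_apply]; ring
    · rfl
  map_smul' c ψ := by
    split_ifs
    · funext b; simp only [applyHad, Pi.smul_apply, smul_eq_mul, RingHom.id_apply]; ring
    · rfl

theorem hadL_apply (r : Fin k) (i : ℕ) (ψ : QState k w) :
    hadL r i ψ = if h : i < w then applyHad r ⟨i, h⟩ ψ else ψ := rfl

theorem hadL_hadL (r : Fin k) (i : ℕ) (ψ : QState k w) : hadL r i (hadL r i ψ) = ψ := by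
  by_cases h : i < w
  · simp only [hadL_apply, h, dite_true]
    funext b
    have h2 := sqrt_two_sq
    have h0 := sqrt_two_ne_zero
    cases hb : b r ⟨i, h⟩
    · simp only [applyHad, setBit_setBit, setBit_apply, hb, setBit_eq_self _ _ _ hb]
      simp only [and_self, if_true, Bool.false_eq_true, if_false]
      field_simp
      linear_combination (-ψ b) * h2
    · simp only [applyHad, setBit_setBit, setBit_apply, hb, setBit_eq_self _ _ _ hb]
      simp only [and_self, if_true, Bool.false_eq_true, if_false]
      field_simp
      linear_combination (-ψ b) * h2
  · simp [hadL_apply, h]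

theorem hadL_comm (r : Fin k) (i j : ℕ) (ψ : QState k w) :
    hadL r i (hadL r j ψ) = hadL r j (hadL r i ψ) := by
  by_cases hij : i = j
  · rw [hij]
  by_cases hi : i < w
  · by_cases hj : j < w
    · simp only [hadL_apply, hi, hj, dite_true]
      funext b
      have hne : (r, (⟨i, hi⟩ : Fin w)) ≠ (r, ⟨j, hj⟩) := by simpa using hij
      have e1 : ∀ v, setBit b r ⟨i, hi⟩ v r ⟨j, hj⟩ = b r ⟨j, hj⟩ := fun v => by
        rw [setBit_apply, if_neg]; simpa using fun h => hij h.symm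
      have e2 : ∀ v, setBit b r ⟨j, hj⟩ v r ⟨i, hi⟩ = b r ⟨i, hi⟩ := fun v => by
        rw [setBit_apply, if_neg]; simpa using hij
      simp only [applyHad, e1, e2, setBit_comm b hne]
      ring
    · simp [hadL_apply, hj]
  · simp [hadL_apply, hi]

/-- Hadamard gates on the qubits `0, …, l - 1` of register `r`. -/
def hads (r : Fin k) : ℕ → QState k w →ₗ[ℂ] QState k w
  | 0 => LinearMap.id
  | l + 1 => hads r l ∘ₗ hadL r l

theorem hads_zero (r : Fin k) (ψ : QState k w) : hads r 0 ψ = ψ := rfl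

theorem hads_succ (r : Fin k) (l : ℕ) (ψ : QState k w) :
    hads r (l + 1) ψ = hads r l (hadL r l ψ) := rfl

/-- Gates on different qubits commute, so a factor can be peeled off a layer at either end. -/
theorem hads_hadL (r : Fin k) (l i : ℕ) (ψ : QState k w) :
    hads r l (hadL r i ψ) = hadL r i (hads r l ψ) := by
  induction l generalizing ψ with
  | zero => rfl
  | succ l ih => rw [hads_succ, hads_succ, hadL_comm, ih]

theorem hads_hads (r : Fin k) (l : ℕ) (ψ : QState k w) : hads r l (hads r l ψ) = ψ := by
  induction l generalizing ψ with
  | zero => rfl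
  | succ l ih => rw [hads_succ, hads_succ, ← hads_hadL, ih, hadL_hadL]

/-- The basis states that differ from `z` at most in the qubits `0, …, l - 1` of register `r`. -/
def cube (z : Basis k w) (r : Fin k) (l : ℕ) : Finset (Basis k w) :=
  {b | (∀ r', r' ≠ r → b r' = z r') ∧ ∀ i : Fin w, l ≤ i → b r i = z r i}

theorem mem_cube {z b : Basis k w} {r : Fin k} {l : ℕ} :
    b ∈ cube z r l ↔ (∀ r', r' ≠ r → b r' = z r') ∧ ∀ i : Fin w, l ≤ i → b r i = z r i := by
  simp [cube]

theorem self_mem_cube (z : Basis k w) (r : Fin k) (l : ℕ) : z ∈ cube z r l := by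
  simp [mem_cube]

theorem cube_zero (z : Basis k w) (r : Fin k) : cube z r 0 = {z} := by
  ext b
  simp only [mem_cube, Finset.mem_singleton, Nat.zero_le, true_imp_iff]
  refine ⟨fun h => funext fun r' => ?_, by rintro rfl; simp⟩
  by_cases hr : r' = r
  · subst hr; exact funext h.2
  · exact h.1 r' hr

theorem mem_cube_setBit {z b : Basis k w} {r : Fin k} {l : ℕ} (hl : l < w) (v : Bool) :
    b ∈ cube (setBit z r ⟨l, hl⟩ v) r l ↔ b ∈ cube z r (l + 1) ∧ b r ⟨l, hl⟩ = v := by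
  have e1 : ∀ r', r' ≠ r → setBit z r ⟨l, hl⟩ v r' = z r' := fun r' hr => by
    simp [setBit, hr]
  simp only [mem_cube]
  constructor
  · rintro ⟨h1, h2⟩
    refine ⟨⟨fun r' hr => (h1 r' hr).trans (e1 r' hr), fun i hi => ?_⟩, ?_⟩
    · rw [h2 i (by omega), setBit_apply, if_neg]
      rintro ⟨-, rfl⟩
      simp at hi
    · rw [h2 _ le_rfl, setBit_apply]; simp
  · rintro ⟨⟨h1, h2⟩, h3⟩
    refine ⟨fun r' hr => (h1 r' hr).trans (e1 r' hr).symm, fun i hi => ?_⟩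
    rw [setBit_apply]
    split_ifs with h
    · rw [h.2, h3]
    · refine h2 i (lt_of_le_of_ne hi fun h' => h ⟨rfl, Fin.ext h'.symm⟩)

theorem sum_cube_succ (z : Basis k w) (r : Fin k) {l : ℕ} (hl : l < w)
    {M : Type*} [AddCommMonoid M] (f : Basis k w → M) :
    ∑ b ∈ cube z r (l + 1), f b =
      ∑ b ∈ cube (setBit z r ⟨l, hl⟩ false) r l, f b +
        ∑ b ∈ cube (setBit z r ⟨l, hl⟩ true) r l, f b := by
  rw [← Finset.sum_filter_add_sum_filter_not (cube z r (l + 1)) fun b => b r ⟨l, hl⟩ = false]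
  congr 1 <;> refine Finset.sum_congr (Finset.ext fun b => ?_) fun _ _ => rfl
  · simp [mem_cube_setBit hl]
  · simp [mem_cube_setBit hl]

theorem card_cube (z : Basis k w) (r : Fin k) {l : ℕ} (hl : l ≤ w) :
    (cube z r l).card = 2 ^ l := by
  induction l generalizing z with
  | zero => simp [cube_zero]
  | succ l ih =>
    rw [Finset.card_eq_sum_ones, sum_cube_succ z r (by omega), ← Finset.card_eq_sum_ones,
      ← Finset.card_eq_sum_ones, ih _ (by omega), ih _ (by omega)]
    ring

theorem hadL_setBit (r : Fin k) {l : ℕ} (hl : l < w) (ψ : QState k w) (b : Basis k w) :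
    hadL r l ψ b = (ψ (setBit b r ⟨l, hl⟩ false) +
      (if b r ⟨l, hl⟩ then -1 else 1) * ψ (setBit b r ⟨l, hl⟩ true)) / (Real.sqrt 2 : ℂ) := by
  rw [hadL_apply, dif_pos hl]; rfl

/-- The entries of the row of `z` in the Hadamard matrix carry no signs, because the qubits
concerned are `0` in `z`. -/
theorem hads_apply (r : Fin k) {l : ℕ} (hl : l ≤ w) (ψ : QState k w) {z : Basis k w}
    (hz : ∀ i : Fin w, (i : ℕ) < l → z r i = false) :
    hads r l ψ z = (∑ b ∈ cube z r l, ψ b) / (Real.sqrt 2 : ℂ) ^ l := by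
  induction l generalizing z ψ with
  | zero => simp [hads_zero, cube_zero]
  | succ l ih =>
    rw [hads_succ, hads_hadL, hadL_setBit r hl, ih (by omega), ih (by omega),
      sum_cube_succ z r hl, hz ⟨l, hl⟩ (by simp)]
    · simp only [Bool.false_eq_true, if_false]
      rw [pow_succ]
      field_simp
    · intro i hi
      rw [setBit_apply, if_neg (fun h => by rw [h.2] at hi; simp at hi), hz i (by omega)]
    · intro i hi
      rw [setBit_apply, if_neg (fun h => by rw [h.2] at hi; simp at hi), hz i (by omega)]

theorem hads_ket (r : Fin k) {l : ℕ} (hl : l ≤ w) {z : Basis k w}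
    (hz : ∀ i : Fin w, (i : ℕ) < l → z r i = false) (b : Basis k w) :
    hads r l (ket z) b = (if b ∈ cube z r l then 1 else 0) / (Real.sqrt 2 : ℂ) ^ l := by
  induction l generalizing b with
  | zero => simp [hads_zero, cube_zero, ket]
  | succ l ih =>
    have hz' : ∀ i : Fin w, (i : ℕ) < l → z r i = false := fun i hi => hz i (by omega)
    have hc : ∀ v, setBit b r ⟨l, hl⟩ v ∈ cube z r l ↔ b ∈ cube z r (l + 1) ∧ v = false := by
      intro v
      have hzz := mem_cube_setBit (z := z) (b := setBit b r ⟨l, hl⟩ v) (r := r) hl false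
      rw [setBit_eq_self z _ _ (hz ⟨l, hl⟩ (by simp))] at hzz
      rw [hzz]
      refine and_congr ?_ (by simp [setBit_apply])
      simp only [mem_cube]
      refine and_congr (forall₂_congr fun r' hr => by simp [setBit, hr])
        (forall₂_congr fun i hi => ?_)
      rw [setBit_apply, if_neg (fun h => by rw [h.2] at hi; simp at hi)]
    rw [hads_succ, hads_hadL, hadL_setBit r hl, ih (by omega) hz', ih (by omega) hz']
    simp only [hc]
    simp [pow_succ, div_div]

theorem hads_support (r : Fin k) {l : ℕ} {z : Basis k w} {m : ℕ} (hlm : l ≤ m)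
    {ψ : QState k w} (h : ∀ b, b ∉ cube z r m → ψ b = 0) :
    ∀ b, b ∉ cube z r m → hads r l ψ b = 0 := by
  induction l generalizing ψ with
  | zero => exact h
  | succ l ih =>
    refine ih (by omega) fun b hb => ?_
    by_cases hl : l < w
    · have hc : ∀ v, setBit b r ⟨l, hl⟩ v ∉ cube z r m := fun v hv => hb (by
        rw [mem_cube] at hv ⊢
        refine ⟨fun r' hr => by simpa [setBit, hr] using hv.1 r' hr, fun i hi => ?_⟩
        have := hv.2 i hi
        rwa [setBit_apply, if_neg] at this
        rintro ⟨-, rfl⟩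
        simp at hi
        omega)
      rw [hadL_setBit r hl, h _ (hc _), h _ (hc _)]
      simp
    · rw [hadL_apply, dif_neg hl]; exact h b hb

theorem sqrt_two_pow_sq (l : ℕ) :
    (Real.sqrt 2 : ℂ) ^ l * (Real.sqrt 2 : ℂ) ^ l = 2 ^ l := by
  rw [← mul_pow, sqrt_two_sq]

/-- The reflection about the uniform superposition of a cube. -/
theorem diffusion (r : Fin k) {l : ℕ} (hl : l ≤ w) {z : Basis k w}
    (hz : ∀ i : Fin w, (i : ℕ) < l → z r i = false) {σ : Basis k w → Bool}
    (hσ : ∀ b ∈ cube z r l, σ b = true ↔ b = z) {φ : QState k w}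
    (hφ : ∀ b, b ∉ cube z r l → φ b = 0) :
    hads r l (fun b => (if σ b then -1 else 1) * hads r l φ b) =
      fun b => φ b - 2 * (if b ∈ cube z r l then (∑ b ∈ cube z r l, φ b) / 2 ^ l else 0) := by
  -- On the cube the phase changes the sign at `z` only, that is, it subtracts twice the component
  -- at `z`. Conjugation by the involution `hads` turns this into subtraction of twice the
  -- projection to the uniform superposition.
  have h1 : (fun b => (if σ b then -1 else 1) * hads r l φ b) =
      hads r l φ - (2 * hads r l φ z) • ket z := by
    funext b
    by_cases hb : b ∈ cube z r l
    · by_cases hbz : b = z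
      · have := (hσ b hb).2 hbz
        subst hbz
        simp [this, ket]
        ring
      · have : σ b = false := by simpa using mt (hσ b hb).1 hbz
        simp [this, ket, hbz]
    · have hbz : b ≠ z := fun h => hb (h ▸ self_mem_cube z r l)
      simp [hads_support r le_rfl hφ b hb, ket, hbz]
  rw [h1, map_sub, map_smul, hads_hads]
  funext b
  simp only [Pi.sub_apply, Pi.smul_apply, smul_eq_mul]
  rw [hads_ket r hl hz, hads_apply r hl _ hz, ← sqrt_two_pow_sq]
  split_ifs
  · have := pow_ne_zero l sqrt_two_ne_zero
    field_simp
  · simp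

/-! ### Grover iterations -/

/-- Four `T` gates are a `Z` gate. -/
theorem applyT_four (r : Fin k) (i : Fin w) (ψ : QState k w) :
    applyT r i (applyT r i (applyT r i (applyT r i ψ))) =
      fun b => (if b r i then -1 else 1) * ψ b := by
  funext b
  cases h : b r i
  · simp [applyT, h]
  · have : Complex.exp (Complex.I * (Real.pi / 4 : ℝ)) ^ 4 = -1 := by
      rw [← Complex.exp_nat_mul, ← Complex.exp_pi_mul_I]
      congr 1
      push_cast
      ring
    simp only [applyT, h, if_true]
    linear_combination ψ b * this

/-- The qubit `(t, i)` after two exclusive or operations. -/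
def marked (f₁ f₂ : Basis k w → ℕ) (u t : Fin k) (i : Fin w) (b : Basis k w) : Bool :=
  xorPerm f₂ t (xorPerm f₁ u b) t i

/-- Compute, apply the phase, uncompute: both exclusive or operations are involutions, so the answer
registers are restored and only the sign is left. -/
theorem oracle_phase {f₁ f₂ : Basis k w → ℕ} {u t : Fin k} (h₁ : Indep f₁ u)
    (h₂ : Indep f₂ t) (i : Fin w) (ψ : QState k w) :
    applyXor f₁ u (applyXor f₂ t (fun b => (if b t i then -1 else 1) *
      applyXor f₂ t (applyXor f₁ u ψ) b)) =
      fun b => (if marked f₁ f₂ u t i b then -1 else 1) * ψ b := by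
  funext b
  have e₁ : ∀ b, xorReg (xorReg b u (f₁ b)) u (f₁ (xorReg b u (f₁ b))) = b :=
    xorPerm_involutive h₁
  have e₂ : ∀ b, xorReg (xorReg b t (f₂ b)) t (f₂ (xorReg b t (f₂ b))) = b :=
    xorPerm_involutive h₂
  simp only [applyXor, e₂, e₁, marked, xorPerm]
  rfl

theorem reflect_phase {f : Basis k w → ℕ} {t : Fin k} (h : Indep f t) (i : Fin w)
    (ψ : QState k w) :
    applyXor f t (fun b => (if b t i then -1 else 1) * applyXor f t ψ b) =
      fun b => (if xorPerm f t b t i then -1 else 1) * ψ b := by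
  funext b
  have e : ∀ b, xorReg (xorReg b t (f b)) t (f (xorReg b t (f b))) = b :=
    xorPerm_involutive h
  simp only [applyXor, e, xorPerm]
  rfl

/-- The two exclusive or operations permute the basis states, so the outcome probability is the mass
of `ψ` on the states with the corresponding mark. -/
theorem normSq_flag {f₁ f₂ : Basis k w → ℕ} {u t : Fin k} (h₁ : Indep f₁ u)
    (h₂ : Indep f₂ t) (i : Fin w) (v : Bool) (ψ : QState k w) :
    normSq (project t i v (applyXor f₂ t (applyXor f₁ u ψ))) =
      ∑ b, if marked f₁ f₂ u t i b = v then ‖ψ b‖ ^ 2 else 0 := by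
  have e₁ := xorPerm_involutive h₁
  have e₂ := xorPerm_involutive h₂
  rw [normSq, ← Equiv.sum_comp (e₁.toPerm.trans e₂.toPerm)]
  refine Finset.sum_congr rfl fun b _ => ?_
  have e : (e₁.toPerm.trans e₂.toPerm) b = xorPerm f₂ t (xorPerm f₁ u b) := rfl
  have e' : applyXor f₂ t (applyXor f₁ u ψ) (xorPerm f₂ t (xorPerm f₁ u b)) = ψ b := by
    change ψ (xorPerm f₁ u (xorPerm f₂ t (xorPerm f₂ t (xorPerm f₁ u b)))) = ψ b
    rw [e₂, e₁]
  rw [e, project, e', marked]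
  split_ifs <;> simp

/-- The state with amplitude `a` on the marked and `b` on the other elements of `C`. -/
def blend (C : Finset (Basis k w)) (m : Basis k w → Bool) (a b : ℂ) : QState k w :=
  fun x => if x ∈ C then (if m x then a else b) else 0

theorem sum_blend {R : Type*} [CommRing R] (C : Finset (Basis k w)) (m : Basis k w → Bool)
    (a b : R) :
    ∑ x ∈ C, (if m x then a else b) =
      (C.filter fun x => m x).card * a + (C.card - (C.filter fun x => m x).card) * b := by
  rw [Finset.sum_ite, Finset.sum_const, Finset.sum_const, nsmul_eq_mul, nsmul_eq_mul,
    ← Finset.card_filter_add_card_filter_not (s := C) fun x => m x = true]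
  push_cast
  ring

theorem sum_marked_blend (C : Finset (Basis k w)) (m : Basis k w → Bool) (a b : ℂ) (v : Bool) :
    (∑ x, if m x = v then ‖blend C m a b x‖ ^ 2 else 0) =
      if v then (C.filter fun x => m x).card * ‖a‖ ^ 2 else
        (C.card - (C.filter fun x => m x).card) * ‖b‖ ^ 2 := by
  cases v
  · have h := sum_blend C m 0 (‖b‖ ^ 2)
    rw [mul_zero, zero_add] at h
    rw [if_neg (by simp), ← h]
    rw [← Finset.sum_filter_add_sum_filter_not Finset.univ (fun x => x ∈ C)]
    simp only [Finset.filter_mem_eq_inter, Finset.univ_inter]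
    rw [Finset.sum_eq_zero (s := Finset.univ.filter fun x => x ∉ C), add_zero]
    · refine Finset.sum_congr rfl fun x hx => ?_
      cases hm : m x <;> simp [blend, hx, hm]
    · intro x hx
      simp [blend, (Finset.mem_filter.1 hx).2]
  · have h := sum_blend C m (‖a‖ ^ 2) 0
    rw [mul_zero, add_zero] at h
    rw [if_pos rfl, ← h]
    rw [← Finset.sum_filter_add_sum_filter_not Finset.univ (fun x => x ∈ C)]
    simp only [Finset.filter_mem_eq_inter, Finset.univ_inter]
    rw [Finset.sum_eq_zero (s := Finset.univ.filter fun x => x ∉ C), add_zero]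
    · refine Finset.sum_congr rfl fun x hx => ?_
      cases hm : m x <;> simp [blend, hx, hm]
    · intro x hx
      simp [blend, (Finset.mem_filter.1 hx).2]

/-- The effect of a Grover iteration on the two amplitudes, for `t` marked elements out of `N`. -/
def groverStep (t N : ℝ) (x : ℝ × ℝ) : ℝ × ℝ :=
  (-x.1 - 2 * ((-t * x.1 + (N - t) * x.2) / N), x.2 - 2 * ((-t * x.1 + (N - t) * x.2) / N))

/-- The two amplitudes after `j` Grover iterations. -/
def groverAmp (t N : ℝ) (j : ℕ) : ℝ × ℝ := (groverStep t N)^[j] (1 / √N, 1 / √N)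

theorem groverAmp_succ (t N : ℝ) (j : ℕ) :
    groverAmp t N (j + 1) = groverStep t N (groverAmp t N j) :=
  Function.iterate_succ_apply' ..

/-- Conservation of the total probability: a sign change of one amplitude and a reflection about the
mean both preserve this quadratic form. It eliminates the failure probability in the analysis of a
trial. -/
theorem groverAmp_norm {t N : ℝ} (hN : 0 < N) (j : ℕ) :
    t * (groverAmp t N j).1 ^ 2 + (N - t) * (groverAmp t N j).2 ^ 2 = 1 := by
  induction j with
  | zero =>
    simp only [groverAmp, Function.iterate_zero, id]
    rw [div_pow, Real.sq_sqrt hN.le]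
    field_simp
    ring
  | succ j ih =>
    rw [groverAmp_succ, groverStep]
    rw [← ih]
    field_simp
    ring

/-- States that are constant on the marked and on the unmarked part of the cube form an invariant
plane, so an iteration reduces to a map of two amplitudes. The factor `c` is the scalar of the
current branch of the run. -/
theorem grover_iteration (r : Fin k) {l : ℕ} (hl : l ≤ w) {z : Basis k w}
    (hz : ∀ i : Fin w, (i : ℕ) < l → z r i = false) {σ : Basis k w → Bool}
    (hσ : ∀ b ∈ cube z r l, σ b = true ↔ b = z) (m : Basis k w → Bool) (c : ℂ) (x : ℝ × ℝ)
    {N : ℝ} (hN : N = 2 ^ l) :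
    hads r l (fun b => (if σ b then -1 else 1) * hads r l (fun b => (if m b then -1 else 1) *
      blend (cube z r l) m (c * x.1) (c * x.2) b) b) =
    blend (cube z r l) m
      (c * (groverStep ((cube z r l).filter fun x => m x).card N x).1)
      (c * (groverStep ((cube z r l).filter fun x => m x).card N x).2) := by
  have h1 : (fun b => (if m b then -1 else 1) *
      blend (cube z r l) m (c * x.1) (c * x.2) b) =
      blend (cube z r l) m (-(c * x.1)) (c * x.2) := by
    funext b
    rw [blend, blend]
    split_ifs <;> simp
  have h2 : ∑ b ∈ cube z r l, blend (cube z r l) m (-(c * x.1)) (c * x.2) b =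
      c * (-((cube z r l).filter fun x => m x).card * x.1 +
        (N - ((cube z r l).filter fun x => m x).card) * x.2) := by
    rw [Finset.sum_congr rfl (g := fun b => if m b then -(c * (x.1 : ℂ)) else c * x.2)
      (fun b hb => by simp [blend, hb]), sum_blend, card_cube z r hl, hN]
    push_cast
    ring
  rw [h1, diffusion r hl hz hσ (fun b hb => by simp [blend, hb]), h2]
  funext b
  rw [blend, blend, ← show ((N : ℝ) : ℂ) = 2 ^ l by rw [hN]; push_cast; rfl]
  simp only [groverStep]
  push_cast
  split_ifs <;> ring

/-- Each term `2 sin (2θ) cos ((4j+2)θ)` equals `sin (4(j+1)θ) - sin (4jθ)`. -/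
theorem sum_cos_telescope (θ : ℝ) (M : ℕ) :
    2 * Real.sin (2 * θ) * ∑ j ∈ Finset.range M, Real.cos ((4 * j + 2) * θ) =
      Real.sin (4 * M * θ) := by
  induction M with
  | zero => simp
  | succ M ih =>
    rw [Finset.sum_range_succ, mul_add, ih]
    have h1 : (4 * ((M + 1 : ℕ) : ℝ) * θ) = (4 * M + 2) * θ + 2 * θ := by push_cast; ring
    have h2 : (4 * (M : ℝ) * θ) = (4 * M + 2) * θ - 2 * θ := by ring
    rw [h1, h2, Real.sin_add, Real.sin_sub]
    ring

/-- Since `sin²` is `1/2` minus half a cosine of the double angle, it suffices that the cosines sum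
to at most `M / 2`; by the telescoping identity their sum is at most `1 / (2 sin (2θ))`. -/
theorem sum_sin_sq_ge {θ : ℝ} {M : ℕ} (h : 1 ≤ M * Real.sin (2 * θ)) :
    (M : ℝ) / 4 ≤ ∑ j ∈ Finset.range M, Real.sin ((2 * j + 1) * θ) ^ 2 := by
  have h1 : ∀ j : ℕ, Real.sin ((2 * j + 1) * θ) ^ 2 =
      1 / 2 - 1 / 2 * Real.cos ((4 * j + 2) * θ) := fun j => by
    rw [Real.sin_sq_eq_half_sub]
    ring_nf
  rw [Finset.sum_congr rfl fun j _ => h1 j, Finset.sum_sub_distrib, ← Finset.mul_sum,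
    Finset.sum_const, Finset.card_range, nsmul_eq_mul]
  have h2 := sum_cos_telescope θ M
  set X := ∑ j ∈ Finset.range M, Real.cos ((4 * j + 2) * θ)
  have h3 := Real.sin_le_one (4 * M * θ)
  have hM : (0 : ℝ) ≤ M := Nat.cast_nonneg M
  have hs : 0 < Real.sin (2 * θ) := by
    by_contra hs
    nlinarith
  have : X ≤ M / 2 := by
    by_contra hX
    push Not at hX
    nlinarith
  linarith

/-- In the coordinates `(√t * a, √(N - t) * b)` an iteration is, up to sign, the rotation by `2θ`,
and the uniform superposition lies at angle `θ`. -/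
theorem groverAmp_sin {t N θ : ℝ} (ht : 0 < t) (htN : t < N)
    (hs : Real.sin θ = √t / √N) (hc : Real.cos θ = √(N - t) / √N) (j : ℕ) :
    t * (groverAmp t N j).1 ^ 2 = Real.sin ((2 * j + 1) * θ) ^ 2 := by
  have hN : 0 < N := ht.trans htN
  have hsN : 0 < √N := Real.sqrt_pos.2 hN
  have hNN : √N ^ 2 = N := Real.sq_sqrt hN.le
  have hS : √t = √N * Real.sin θ := by rw [hs]; field_simp
  have hK : √(N - t) = √N * Real.cos θ := by rw [hc]; field_simp
  have htt : t = N * Real.sin θ ^ 2 := by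
    rw [← Real.sq_sqrt ht.le, hS, mul_pow, hNN]
  have hkk : N - t = N * Real.cos θ ^ 2 := by
    rw [← Real.sq_sqrt (sub_pos.2 htN).le, hK, mul_pow, hNN]
  -- The reflection used is identity minus twice the projection, the negative of the usual one;
  -- hence the sign `(-1) ^ j`.
  have key : √N * Real.sin θ * (groverAmp t N j).1 = (-1) ^ j * Real.sin ((2 * j + 1) * θ) ∧
      √N * Real.cos θ * (groverAmp t N j).2 = (-1) ^ j * Real.cos ((2 * j + 1) * θ) := by
    induction j with
    | zero =>
      simp only [groverAmp, Function.iterate_zero, id]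
      constructor
      · field_simp; simp
      · field_simp; simp
    | succ j ih =>
      obtain ⟨ha, hb⟩ := ih
      rw [groverAmp_succ, groverStep]
      have h1 : (2 * ((j + 1 : ℕ) : ℝ) + 1) * θ = (2 * j + 1) * θ + 2 * θ := by push_cast; ring
      rw [h1, Real.sin_add, Real.cos_add, Real.cos_two_mul, Real.sin_two_mul, pow_succ, hkk]
      set a := (groverAmp t N j).1
      set b := (groverAmp t N j).2
      set x := (2 * (j : ℝ) + 1) * θ
      have hsc := Real.sin_sq_add_cos_sq θ
      have h2 : (-t * a + N * Real.cos θ ^ 2 * b) / N =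
          -Real.sin θ ^ 2 * a + Real.cos θ ^ 2 * b := by
        rw [htt]; field_simp
      rw [h2]
      constructor
      · linear_combination (2 * Real.sin θ ^ 2 - 1) * ha -
          2 * Real.sin θ * Real.cos θ * hb +
          2 * (-1) ^ j * Real.sin x * hsc
      · linear_combination (1 - 2 * Real.cos θ ^ 2) * hb +
          2 * Real.sin θ * Real.cos θ * ha
  have := congrArg (· ^ 2) key.1
  simp only [mul_pow] at this
  rw [hNN, ← pow_mul, mul_comm j 2, pow_mul] at this
  rw [htt]
  norm_num at this
  rw [← htt] at *
  exact this

/-- A random number of at most `√N` iterations finds a marked element with probability at least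
`1/4`. -/
theorem sum_groverAmp_ge {t N : ℝ} {M : ℕ} (ht : 1 ≤ t) (htN : 2 * t ≤ N)
    (hM : N = M ^ 2) :
    (M : ℝ) / 4 ≤ ∑ j ∈ Finset.range M, t * (groverAmp t N j).1 ^ 2 := by
  have ht0 : 0 < t := by linarith
  have htN' : t < N := by linarith
  have hN : 0 < N := by linarith
  have hx : √t / √N ≤ 1 := by
    rw [div_le_one (Real.sqrt_pos.2 hN)]; exact Real.sqrt_le_sqrt htN'.le
  have hx0 : 0 ≤ √t / √N := by positivity
  have hs : Real.sin (Real.arcsin (√t / √N)) = √t / √N :=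
    Real.sin_arcsin (by linarith) hx
  have hc : Real.cos (Real.arcsin (√t / √N)) = √(N - t) / √N := by
    rw [Real.cos_arcsin, div_pow, Real.sq_sqrt ht0.le, Real.sq_sqrt hN.le,
      ← Real.sqrt_div (by linarith), sub_div, div_self hN.ne']
  set θ := Real.arcsin (√t / √N)
  rw [Finset.sum_congr rfl fun j _ => groverAmp_sin ht0 htN' hs hc j]
  -- Here `M sin (2θ) = 2 √(t (N - t)) / M`, and `t ≥ 1`, `N - t ≥ N / 2` give `t (N - t) ≥ N / 2 ≥
  -- M ^ 2 / 4`.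
  refine sum_sin_sq_ge ?_
  have hMs : √N = M := by rw [hM, Real.sqrt_sq (Nat.cast_nonneg M)]
  have hM0 : (0 : ℝ) < M := by rw [← hMs]; exact Real.sqrt_pos.2 hN
  rw [Real.sin_two_mul, hs, hc, hMs]
  have h1 : √t * √(N - t) = √(t * (N - t)) := (Real.sqrt_mul ht0.le _).symm
  have h2 : (M : ℝ) / 2 ≤ √(t * (N - t)) := by
    refine Real.le_sqrt_of_sq_le ?_
    rw [div_pow, ← hM]
    nlinarith
  have h3 : (M : ℝ) * (2 * (√t / M) * (√(N - t) / M)) = 2 * √(t * (N - t)) / M := by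
    rw [← h1]; field_simp
  rw [h3, le_div_iff₀ hM0]
  linarith

/-! ### Effects of program pieces -/

/-- From `s` to `s'` the arrays do not change, only registers in `X` change, and there are at most
`T` operations. -/
structure Eff (X : Set ℕ) (T : ℕ) (s s' : St k w) : Prop where
  arr : s'.arr = s.arr
  reg : ∀ r, r ∉ X → s'.reg r = s.reg r
  time : s'.time ≤ s.time + T
  qtime : s'.qtime ≤ s.qtime + T

theorem Eff.refl (X : Set ℕ) (s : St k w) : Eff X 0 s s := ⟨rfl, fun _ _ => rfl, le_rfl, le_rfl⟩

theorem Eff.trans {X : Set ℕ} {T T' : ℕ} {s s' s'' : St k w} (h : Eff X T s s')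
    (h' : Eff X T' s' s'') : Eff X (T + T') s s'' where
  arr := h'.arr.trans h.arr
  reg r hr := (h'.reg r hr).trans (h.reg r hr)
  time := by have := h.time; have := h'.time; omega
  qtime := by have := h.qtime; have := h'.qtime; omega

theorem Eff.mono {X Y : Set ℕ} {T T' : ℕ} {s s' : St k w} (h : Eff X T s s') (hX : X ⊆ Y)
    (hT : T ≤ T') : Eff Y T' s s' where
  arr := h.arr
  reg r hr := h.reg r fun h' => hr (hX h')
  time := h.time.trans (by omega)
  qtime := h.qtime.trans (by omega)

theorem Eff.tick {X : Set ℕ} {T : ℕ} {s s' : St k w} (h : Eff X T s s') :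
    Eff X (T + 1) s s'.tick :=
  h.trans ⟨rfl, fun _ _ => rfl, le_rfl, Nat.le_succ _⟩

theorem Eff.set {X : Set ℕ} {T : ℕ} {s s' : St k w} (h : Eff X T s s') {x : ℕ} (hx : x ∈ X)
    (a : ℕ) : Eff X (T + 1) s (s'.set x a) :=
  h.trans ⟨rfl, fun r hr => by rw [St.set_reg, if_neg]; rintro rfl; exact hr hx, le_rfl,
    Nat.le_succ _⟩

theorem Eff.quant {X : Set ℕ} {T : ℕ} {s s' : St k w} (h : Eff X T s s') (ψ : QState k w) :
    Eff X (T + 1) s (s'.quant ψ) :=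
  h.trans ⟨rfl, fun _ _ => rfl, le_rfl, le_rfl⟩

theorem Eff.measured {X : Set ℕ} {T : ℕ} {s s' : St k w} (h : Eff X T s s') {y : ℕ}
    (hy : y ∈ X) (v : ℕ) (ψ : QState k w) : Eff X (T + 1) s (s'.measured y v ψ) :=
  h.trans ⟨rfl, fun r hr => by rw [St.measured_reg, if_neg]; rintro rfl; exact hr hy, le_rfl,
    le_rfl⟩

/-! ### The program

Classical registers: `0` number of vertices, `1`, `6`, `7`, `8`, `9` the constants `1, 0, 2, 4, 5`,
`2` word length, `3` number of remaining vertices, `4` current vertex, `5` its degree (or `n`),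
`10` half the number of index qubits, `11` number of index qubits, `12` scratch, `13` number of
remaining trials, `20` search result, `21` number of Grover iterations, `22` qubit position,
`23` measurement outcome, `24` scratch.

Quantum registers: `0` vertex, `1` index, `2` first answer, `3` second answer. -/

namespace Mis

/-- The first step towards the predicate that is searched for. -/
def ask₁ (mat : Bool) : Prog 4 := if mat then .lookup 1 1 2 else .query 0 1 2

/-- The second step towards the predicate that is searched for. -/
def ask₂ (mat : Bool) : Prog 4 := if mat then .query 0 2 3 else .lookup 1 2 3

/-- The language has no empty program, so a write to an otherwise unused register takes its place.
-/
def skip : Prog 4 := .const 24 0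

/-- A phase `-1` controlled by the lowest qubit of register `3`. -/
def zgate : Prog 4 := .seq (.tgate 3 6) (.seq (.tgate 3 6) (.seq (.tgate 3 6) (.tgate 3 6)))

/-- Register `6` holds `0`, so the addition is a copy. The gates are applied one at a time, and a
layer costs a logarithmic number of operations; this is one of the two logarithmic factors of the
theorem. -/
def hadsProg : Prog 4 := .seq (.op .add 22 11 6) (.down 22 1 (.had 1 22))

/-- The first half marks the hits by a sign and uncomputes the answers. The second half is the
reflection: array `3` is the indicator of the index `0`, so looking it up around a `Z` gate changes
the sign at index `0`. -/
def iteration (mat : Bool) : Prog 4 :=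
  .seq (ask₁ mat) (.seq (ask₂ mat) (.seq zgate (.seq (ask₂ mat) (.seq (ask₁ mat) (.seq hadsProg
    (.seq (.lookup 3 1 3) (.seq zgate (.seq (.lookup 3 1 3) hadsProg))))))))

def coin : Prog 4 :=
  .seq (.had 3 6) (.seq (.meas 23 3 6) (.seq (.ite 23 (.xgate 3 6) skip)
    (.seq (.op .add 21 21 21) (.op .add 21 21 23))))

/-- Draw a random number below `2 ^ R[10]`. -/
def coins : Prog 4 :=
  .seq (.const 21 0) (.seq (.op .add 22 10 6) (.down 22 1 coin))

def clear (r : Fin 4) : Prog 4 := .seq (.meas 23 r 22) (.ite 23 (.xgate r 22) skip)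

/-- Measure all qubits and reset them to `0`. -/
def reset : Prog 4 :=
  .seq (.op .add 22 2 6)
    (.down 22 1 (.seq (clear 0) (.seq (clear 1) (.seq (clear 2) (clear 3)))))

def flag (mat : Bool) : Prog 4 :=
  .seq (ask₁ mat) (.seq (ask₂ mat) (.seq (.meas 23 3 6) (.ite 23 (.const 20 1) skip)))

/-- At the time of the lookup the index register is `0`, so `A_2[0]` is read; this transfers the
current vertex from a classical cell to quantum register `0`. -/
def trial (mat : Bool) : Prog 4 :=
  .seq coins (.seq (.lookup 2 1 0) (.seq hadsProg (.seq (.down 21 1 (iteration mat))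
    (.seq (flag mat) reset))))

/-- The function computed by the first step. -/
def ans₁ (mat : Bool) (O : ℕ → ℕ → ℕ) (A : ℕ → ℕ) (b : Basis 4 w) : ℕ :=
  if mat then A (regVal b 1) else O (regVal b 0) (regVal b 1)

/-- The function computed by the second step. -/
def ans₂ (mat : Bool) (O : ℕ → ℕ → ℕ) (A : ℕ → ℕ) (b : Basis 4 w) : ℕ :=
  if mat then O (regVal b 0) (regVal b 2) else A (regVal b 2)

theorem indep_ans₁ (mat : Bool) (O : ℕ → ℕ → ℕ) (A : ℕ → ℕ) :
    Indep (w := w) (ans₁ mat O A) 2 := by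
  cases mat
  · exact indep_two O (by decide) (by decide)
  · exact indep_one A (by decide)

theorem indep_ans₂ (mat : Bool) (O : ℕ → ℕ → ℕ) (A : ℕ → ℕ) :
    Indep (w := w) (ans₂ mat O A) 3 := by
  cases mat
  · exact indep_one A (by decide)
  · exact indep_two O (by decide) (by decide)

/-! ### Specifications of the gates, queries and Grover iterations -/

section specs

variable {O : ℕ → ℕ → ℕ} {s : St 4 w} {v : ℝ} {Φ : St 4 w → ℝ → Prop}

theorem wp_ask₁ {mat : Bool} (h : Φ (s.quant (applyXor (ans₁ mat O (s.arr 1)) 2 s.psi)) v) :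
    Wp O (ask₁ mat) s v Φ := by
  cases mat
  · exact wp_query (by decide) (by decide) h
  · exact wp_lookup (by decide) h

theorem wp_ask₂ {mat : Bool} (h : Φ (s.quant (applyXor (ans₂ mat O (s.arr 1)) 3 s.psi)) v) :
    Wp O (ask₂ mat) s v Φ := by
  cases mat
  · exact wp_lookup (by decide) h
  · exact wp_query (by decide) (by decide) h

theorem wp_zgate (hw : 0 < w) (h6 : s.reg 6 = 0)
    (h : ∀ s', s'.psi = (fun b => (if b 3 ⟨0, hw⟩ then -1 else 1) * s.psi b) →
      Eff ∅ 4 s s' → Φ s' v) : Wp O zgate s v Φ := by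
  have h6' : s.reg 6 < w := by omega
  refine wp_seq (wp_tgate h6' (wp_seq (wp_tgate h6' (wp_seq (wp_tgate h6' (wp_tgate h6' ?_))))))
  refine h _ ?_ ((Eff.refl ∅ s).quant _ |>.quant _ |>.quant _ |>.quant _)
  simp only [St.quant_psi, St.quant_reg, h6]
  exact applyT_four _ _ _

theorem wp_hadsProg {l : ℕ} (hl : l < 2 ^ w) (h1 : s.reg 1 = 1) (h6 : s.reg 6 = 0)
    (h11 : s.reg 11 = l)
    (h : ∀ s', s'.psi = hads 1 l s.psi → Eff {22} (3 * l + 2) s s' → Φ s' v) :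
    Wp O hadsProg s v Φ := by
  refine wp_seq (wp_op ?_)
  have e : s.set 22 (BinOp.eval .add (s.reg 11) (s.reg 6)) = s.set 22 l := by
    rw [h11, h6]; rfl
  rw [e]
  have e22 : (s.set 22 l).reg 22 = l := by rw [St.set_reg, if_pos rfl, Nat.mod_eq_of_lt hl]
  refine wp_down (fun i s' v' => v' = v ∧ hads 1 i s'.psi = hads 1 l s.psi ∧
    ∃ i', i' + i = l ∧ Eff {22} (1 + 3 * i') s s') ?_ ?_ (by rw [e22]; exact hl) ?_
  · rintro s' v' ⟨rfl, h', i', hi', he⟩ hx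
    exact h _ h' (he.tick.mono le_rfl (by omega))
  · rintro i s' v' ⟨rfl, h', i', hi', he⟩ hx hi
    refine ⟨by rw [he.reg _ (by simp), h1], wp_had ⟨⟨rfl, ?_, i' + 1, by omega, ?_⟩, ?_⟩⟩
    · rw [← h', hads_succ]
      have : (s'.tick.set 22 i).reg 22 = i := by
        rw [St.set_reg, if_pos rfl, Nat.mod_eq_of_lt hi]
      simp only [St.quant_psi, this]
      rfl
    · exact ((he.tick.set (by simp) i).quant _).mono le_rfl (by omega)
    · rw [St.quant_reg, St.set_reg, if_pos rfl, Nat.mod_eq_of_lt hi]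
  · rw [e22]
    exact ⟨rfl, rfl, 0, by omega, (Eff.refl _ s).set (by simp) _⟩

theorem wp_iteration {mat : Bool} {h : ℕ} {z : Basis 4 w} (hw : 0 < w) (hl : 2 * h ≤ w)
    (h1 : s.reg 1 = 1) (h6 : s.reg 6 = 0) (h11 : s.reg 11 = 2 * h)
    (hz : ∀ r, r ≠ 0 → ∀ i, z r i = false) (hA : s.arr 3 0 = 1)
    (hA' : ∀ x, x ≠ 0 → s.arr 3 x = 0) (c : ℂ) (x : ℝ × ℝ)
    (hψ : s.psi = blend (cube z 1 (2 * h))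
      (marked (ans₁ mat O (s.arr 1)) (ans₂ mat O (s.arr 1)) 2 3 ⟨0, hw⟩) (c * x.1) (c * x.2))
    (hΦ : ∀ s', s'.psi = blend (cube z 1 (2 * h))
        (marked (ans₁ mat O (s.arr 1)) (ans₂ mat O (s.arr 1)) 2 3 ⟨0, hw⟩)
        (c * (groverStep ((cube z 1 (2 * h)).filter fun b =>
          marked (ans₁ mat O (s.arr 1)) (ans₂ mat O (s.arr 1)) 2 3 ⟨0, hw⟩ b).card
            (2 ^ (2 * h)) x).1)
        (c * (groverStep ((cube z 1 (2 * h)).filter fun b =>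
          marked (ans₁ mat O (s.arr 1)) (ans₂ mat O (s.arr 1)) 2 3 ⟨0, hw⟩ b).card
            (2 ^ (2 * h)) x).2) →
      Eff {22} (12 * h + 18) s s' → Φ s' v) :
    Wp O (iteration mat) s v Φ := by
  have hlw : 2 * h < 2 ^ w := hl.trans_lt Nat.lt_two_pow_self
  refine wp_seq (wp_ask₁ (wp_seq (wp_ask₂ (wp_seq (wp_zgate hw h6 ?_)))))
  intro s₁ e₁ f₁
  have a₁ := f₁.arr
  simp only [St.quant_arr, St.quant_psi] at a₁ e₁
  refine wp_seq (wp_ask₂ (wp_seq (wp_ask₁ (wp_seq (wp_hadsProg hlw ?_ ?_ ?_ ?_)))))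
  · simpa [h1] using f₁.reg 1 (by simp)
  · simpa [h6] using f₁.reg 6 (by simp)
  · simpa [h11] using f₁.reg 11 (by simp)
  intro s₂ e₂ f₂
  simp only [St.quant_arr, St.quant_psi, a₁, e₁] at e₂
  rw [oracle_phase (indep_ans₁ _ _ _) (indep_ans₂ _ _ _)] at e₂
  have f₁₂ : Eff {22} (6 * h + 10) s s₂ :=
    (((((Eff.refl _ s).quant _).quant _).trans (f₁.mono (Set.empty_subset _) le_rfl)).trans
      ((((Eff.refl {22} s₁).quant _).quant _).trans f₂)).mono le_rfl (by omega)
  refine wp_seq (wp_lookup (by decide) (wp_seq (wp_zgate hw ?_ ?_)))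
  · simpa [h6] using f₁₂.reg 6 (by simp)
  intro s₃ e₃ f₃
  refine wp_seq (wp_lookup (by decide) (wp_hadsProg hlw ?_ ?_ ?_ ?_))
  · simpa [h1] using (f₃.reg 1 (by simp)).trans (f₁₂.reg 1 (by simp))
  · simpa [h6] using (f₃.reg 6 (by simp)).trans (f₁₂.reg 6 (by simp))
  · simpa [h11] using (f₃.reg 11 (by simp)).trans (f₁₂.reg 11 (by simp))
  intro s₄ e₄ f₄
  have a₃ := f₃.arr
  simp only [St.quant_arr, St.quant_psi, f₁₂.arr, a₃, e₃] at e₄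
  rw [reflect_phase (indep_one _ (by decide)), e₂, hψ, grover_iteration 1 hl
    (fun i _ => hz 1 (by decide) i) _ _ c x rfl] at e₄
  · refine hΦ s₄ e₄ ?_
    exact (((f₁₂.quant _).trans (f₃.mono (Set.empty_subset _) le_rfl)).trans
      (((Eff.refl {22} s₃).quant _).trans f₄)).mono le_rfl (by omega)
  -- Within the cube all registers except the index agree with `z`, so an index of value `0`
  -- identifies `z`.
  · intro b hb
    rw [mem_cube] at hb
    rw [xorPerm, xorReg_apply_self, hb.1 3 (by decide), hz 3 (by decide)]
    constructor
    · intro h'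
      by_cases hx : regVal b 1 = 0
      · funext r
        by_cases hr : r = 1
        · subst hr
          exact regVal_inj (hx.trans (regVal_zero (hz 1 (by decide))).symm)
        · exact hb.1 r hr
      · simp [hA' _ hx] at h'
    · rintro rfl
      simp [regVal_zero (hz 1 (by decide)), hA]

end specs

/-! ### Coins, reset, and a single trial -/

variable {O : ℕ → ℕ → ℕ} {s : St 4 w} {v : ℝ} {Φ : St 4 w → ℝ → Prop}

theorem wp_skip (h : Φ (s.set 24 0) v) : Wp O skip s v Φ := wp_const h

theorem one_mod_two_pow (hw : 0 < w) : 1 % 2 ^ w = 1 :=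
  Nat.mod_eq_of_lt (Nat.one_lt_two_pow hw.ne')

theorem wp_coin (hw : 0 < w) (h6 : s.reg 6 = 0) (α : ℂ) (hψ : s.psi = α • zeroState)
    {j : ℕ} (h21 : s.reg 21 = j) (hj : 2 * j + 1 < 2 ^ w) (v₀ v₁ : ℝ) (hv : v ≤ v₀ + v₁)
    (hΦ : ∀ s' (o : Bool), s'.psi = (α / (Real.sqrt 2 : ℂ)) • zeroState →
      s'.reg 21 = 2 * j + (if o then 1 else 0) → Eff {21, 23, 24} 6 s s' →
      Φ s' (if o then v₁ else v₀)) :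
    Wp O coin s v Φ := by
  refine wp_seq (wp_had (wp_seq ?_))
  simp only [h6, hw, dite_true]
  set s₁ := s.quant (applyHad 3 ⟨0, hw⟩ s.psi) with hs₁
  have e₁ : Eff {21, 23, 24} 1 s s₁ := (Eff.refl _ s).quant _
  have h6' : s₁.reg 6 = 0 := h6
  have h6'' : s₁.reg 6 < w := by omega
  have hp : s₁.psi = applyHad 3 ⟨0, hw⟩ (α • zeroState) := by rw [← hψ]; rfl
  have key : ∀ s' (o : Bool), s'.psi = (α / (Real.sqrt 2 : ℂ)) • zeroState → s'.reg 21 = j →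
      s'.reg 23 = (if o then 1 else 0) → Eff {21, 23, 24} 4 s s' →
      Wp O (.seq (.op .add 21 21 21) (.op .add 21 21 23)) s' (if o then v₁ else v₀) Φ := by
    intro s' o hp' h21' h23' he'
    refine wp_seq (wp_op (wp_op (hΦ _ o hp' ?_ ((he'.set (by simp) _).set (by simp) _))))
    simp only [St.set_reg, BinOp.eval, h21', h23']
    have hjj : (j + j) % 2 ^ w = j + j := Nat.mod_eq_of_lt (by omega)
    cases o
    · simp [hjj]; omega
    · simp only [if_true, hjj]
      norm_num
      rw [Nat.mod_eq_of_lt (by omega)]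
      omega
  refine wp_meas h6'' v₀ v₁ hv (.inr ?_) (.inr ?_)
  · refine wp_seq (wp_ite (fun h => absurd ?_ h) fun _ => wp_skip ?_)
    · simp [St.measured_reg]
    · refine key _ false ?_ ?_ ?_ (((e₁.measured (y := 23) (by simp) _ _).tick).set (x := 24) (by simp) _)
      · simp only [St.set_psi, St.tick_psi, St.measured_psi, h6', hp]
        exact coin_false _ _ _
      · simp [St.set_reg, St.measured_reg, hs₁, h21]
      · simp [St.set_reg, St.measured_reg]
  · refine wp_seq (wp_ite (fun _ => wp_xgate ?_ ?_) fun h => absurd h ?_)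
    · simpa [St.measured_reg] using h6''
    · refine key _ true ?_ ?_ ?_ (((e₁.measured (y := 23) (by simp) _ _).tick).quant _)
      · simp only [St.quant_psi, St.tick_psi, St.tick_reg, St.measured_psi, St.measured_reg, h6',
          hp]
        exact coin_true _ _ _
      · simp [St.measured_reg, hs₁, h21]
      · simp [St.measured_reg, one_mod_two_pow hw]
    · simp [St.measured_reg, one_mod_two_pow hw]

/-- Here `V j` is the value, relative to the squared norm, that the rest of the program secures once
`j` is drawn. The weight that can be promised beforehand is the average of `V`. -/
theorem wp_coins {h : ℕ} (hw : h < w) (h1 : s.reg 1 = 1) (h6 : s.reg 6 = 0)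
    (h10 : s.reg 10 = h) (α : ℂ) (hψ : s.psi = α • zeroState) (V : ℕ → ℝ)
    (hv : v * 2 ^ h ≤ ‖α‖ ^ 2 * ∑ j ∈ Finset.range (2 ^ h), V j)
    (hΦ : ∀ s' v' (α' : ℂ) j, s'.psi = α' • zeroState → s'.reg 21 = j → j < 2 ^ h →
      v' ≤ ‖α'‖ ^ 2 * V j → Eff {21, 22, 23, 24} (8 * h + 3) s s' → Φ s' v') :
    Wp O coins s v Φ := by
  have hw0 : 0 < w := by omega
  have hhw : h < 2 ^ w := hw.trans Nat.lt_two_pow_self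
  have h2w : 2 ^ h < 2 ^ w := Nat.pow_lt_pow_right (by norm_num) hw
  refine wp_seq (wp_const (wp_seq (wp_op ?_)))
  set s₁ := (s.set 21 0).set 22 (BinOp.eval .add ((s.set 21 0).reg 10) ((s.set 21 0).reg 6))
    with hs₁
  have e22 : s₁.reg 22 = h := by
    simp [hs₁, St.set_reg, BinOp.eval, h10, h6, Nat.mod_eq_of_lt hhw]
  -- With `i` coins left, `j` is the binary prefix drawn so far and its completions are `j * 2 ^ i +
  -- j'`. The weight is at most the average of `V` over the completions, times the squared norm.
  refine wp_down (fun i s' v' => ∃ (α' : ℂ) (j : ℕ), s'.psi = α' • zeroState ∧ s'.reg 21 = j ∧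
    (j + 1) * 2 ^ i ≤ 2 ^ h ∧
    v' * 2 ^ i ≤ ‖α'‖ ^ 2 * ∑ j' ∈ Finset.range (2 ^ i), V (j * 2 ^ i + j') ∧
    ∃ i', i' + i = h ∧ Eff {21, 22, 23, 24} (2 + 8 * i') s s') ?_ ?_
    (by rw [e22]; exact hhw) ?_
  · rintro s' v' ⟨α', j, hp, h21, hj, hv', i', hi', he⟩ hx
    refine hΦ _ v' α' j hp h21 (by simpa using hj) ?_ (he.tick.mono le_rfl (by omega))
    simpa using hv'
  · rintro i s' v' ⟨α', j, hp, h21, hj, hv', i', hi', he⟩ hx hi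
    refine ⟨by rw [he.reg _ (by simp), h1], ?_⟩
    have hj2 : (2 * j + 1 + 1) * 2 ^ i ≤ 2 ^ h := by
      calc _ = (j + 1) * 2 ^ (i + 1) := by ring
        _ ≤ _ := hj
    have hj1 : 2 * j + 1 < 2 ^ w := by
      have : 2 * j + 1 + 1 ≤ (2 * j + 1 + 1) * 2 ^ i := Nat.le_mul_of_pos_right _ (by positivity)
      omega
    set S : ℕ → ℝ := fun o => ∑ j' ∈ Finset.range (2 ^ i), V ((2 * j + o) * 2 ^ i + j') with hS
    have hsum : ∑ j' ∈ Finset.range (2 ^ (i + 1)), V (j * 2 ^ (i + 1) + j') = S 0 + S 1 := by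
      rw [pow_succ, mul_two, Finset.sum_range_add, hS]
      refine congrArg₂ _ (Finset.sum_congr rfl fun x _ => ?_)
        (Finset.sum_congr rfl fun x _ => ?_)
      · congr 1; ring
      · congr 1; ring
    rw [hsum] at hv'
    have h2i : (0 : ℝ) < 2 ^ i := by positivity
    refine wp_coin hw0 (j := j) ?_ α' hp ?_ hj1 (‖α'‖ ^ 2 / 2 * S 0 / 2 ^ i)
      (‖α'‖ ^ 2 / 2 * S 1 / 2 ^ i) ?_ ?_
    · rw [St.set_reg, if_neg (by norm_num), St.tick_reg, he.reg _ (by simp), h6]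
    · rw [St.set_reg, if_neg (by norm_num), St.tick_reg, h21]
    · rw [← add_div, le_div_iff₀ h2i]
      rw [pow_succ] at hv'
      linarith
    · intro s'' o hp'' h21'' he''
      have he3 : Eff {21, 22, 23, 24} (2 + 8 * (i' + 1)) s s'' :=
        ((he.tick.set (by simp) i).trans (he''.mono (by simp [Set.insert_subset_iff]) le_rfl)).mono le_rfl (by omega)
      refine ⟨⟨_, _, hp'', h21'', ?_, ?_, i' + 1, by omega, he3⟩, ?_⟩
      · refine le_trans (Nat.mul_le_mul_right _ ?_) hj2
        cases o <;> simp
      · rw [norm_div_sqrt_two_sq]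
        cases o
        · simp only [Bool.false_eq_true, if_false]
          rw [div_mul_cancel₀ _ h2i.ne']
        · simp only [if_true]
          rw [div_mul_cancel₀ _ h2i.ne']
      · rw [he''.reg _ (by simp), St.set_reg, if_pos rfl, Nat.mod_eq_of_lt hi]
  · rw [e22]
    refine ⟨α, 0, hψ, ?_, by simp, by simpa using hv, 0, by omega,
      ((Eff.refl _ s).set (by simp) _).set (by simp) _⟩
    simp [hs₁, St.set_reg]

/-- The weight is kept proportional to the squared norm, with factor `K`. A measurement splits the
squared norm additively, so the weight splits along with it. -/
theorem wp_clear {r : Fin 4} {i : ℕ} (hi : i < w) (h22 : s.reg 22 = i) {K : ℝ}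
    (hv : v ≤ normSq s.psi * K)
    (hΦ : ∀ s' v', v' ≤ normSq s'.psi * K → Clean s'.psi r ⟨i, hi⟩ →
      (∀ r' i', Clean s.psi r' i' → Clean s'.psi r' i') → Eff {23, 24} 3 s s' → Φ s' v') :
    Wp O (clear r) s v Φ := by
  subst h22
  have hw : 0 < w := by omega
  refine wp_seq (wp_meas hi (normSq (project r ⟨_, hi⟩ false s.psi) * K)
    (normSq (project r ⟨_, hi⟩ true s.psi) * K) ?_ (.inr ?_) (.inr ?_))
  · rw [← add_mul, normSq_project_add]; exact hv
  · refine wp_ite (fun h => absurd ?_ h) fun _ => wp_skip ?_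
    · simp [St.measured_reg]
    · exact hΦ _ _ le_rfl (clean_project _ _ _) (fun r' i' h => h.project _)
        ((((Eff.refl _ s).measured (y := 23) (by simp) _ _).tick).set (x := 24) (by simp) _)
  · refine wp_ite (fun _ => wp_xgate (by simpa [St.measured_reg] using hi) ?_) fun h => absurd h ?_
    · have e : (s.measured 23 1 (project r ⟨_, hi⟩ true s.psi)).tick.reg 22 = s.reg 22 := by
        simp [St.measured_reg]
      simp only [e]
      refine hΦ _ _ (by rw [St.quant_psi, normSq_flip]; exact le_rfl)
        (clean_flip_project _ _ _) (fun r' i' h => ?_)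
        ((((Eff.refl _ s).measured (y := 23) (by simp) _ _).tick).quant _)
      by_cases hne : (r', i') = (r, ⟨s.reg 22, hi⟩)
      · obtain ⟨rfl, rfl⟩ := Prod.mk.inj hne
        exact clean_flip_project _ _ _
      · exact (h.project _).flip hne
    · simp [St.measured_reg, one_mod_two_pow hw]

theorem wp_reset (h1 : s.reg 1 = 1) (h2 : s.reg 2 = w) (h6 : s.reg 6 = 0) {K : ℝ}
    (hv : v ≤ normSq s.psi * K)
    (hΦ : ∀ s' v' (α : ℂ), s'.psi = α • zeroState → v' ≤ ‖α‖ ^ 2 * K →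
      Eff {22, 23, 24} (14 * w + 2) s s' → Φ s' v') :
    Wp O reset s v Φ := by
  have hww : w < 2 ^ w := Nat.lt_two_pow_self
  refine wp_seq (wp_op ?_)
  have e : s.set 22 (BinOp.eval .add (s.reg 2) (s.reg 6)) = s.set 22 w := by
    rw [h2, h6]; rfl
  rw [e]
  have e22 : (s.set 22 w).reg 22 = w := by rw [St.set_reg, if_pos rfl, Nat.mod_eq_of_lt hww]
  refine wp_down (fun i s' v' => v' ≤ normSq s'.psi * K ∧
    (∀ r (j : Fin w), i ≤ j → Clean s'.psi r j) ∧
    ∃ i', i' + i = w ∧ Eff {22, 23, 24} (1 + 14 * i') s s') ?_ ?_ (by rw [e22]; exact hww) ?_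
  · rintro s' v' ⟨hv', hc, i', hi', he⟩ hx
    have hz := eq_zeroState_of_clean fun r j => hc r j (Nat.zero_le _)
    refine hΦ _ v' _ hz ?_ (he.tick.mono le_rfl (by omega))
    rwa [hz, zeroState_eq_ket, normSq_smul_ket] at hv'
  · rintro i s' v' ⟨hv', hc, i', hi', he⟩ hx hi
    refine ⟨by rw [he.reg _ (by simp), h1], ?_⟩
    have hiw : i < w := by omega
    set s₀ := s'.tick.set 22 i with hs₀
    have h0 : s₀.reg 22 = i := by rw [St.set_reg, if_pos rfl, Nat.mod_eq_of_lt hi]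
    have e0 : Eff {22, 23, 24} (1 + 14 * i' + 2) s s₀ := he.tick.set (by simp) i
    refine wp_seq (wp_clear hiw h0 hv' ?_)
    intro s₁ v₁ hv₁ c₁ m₁ f₁
    refine wp_seq (wp_clear hiw ((f₁.reg 22 (by simp)).trans h0) hv₁ ?_)
    intro s₂ v₂ hv₂ c₂ m₂ f₂
    refine wp_seq (wp_clear hiw ((f₂.reg 22 (by simp)).trans
      ((f₁.reg 22 (by simp)).trans h0)) hv₂ ?_)
    intro s₃ v₃ hv₃ c₃ m₃ f₃
    refine wp_clear hiw ((f₃.reg 22 (by simp)).trans ((f₂.reg 22 (by simp)).trans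
      ((f₁.reg 22 (by simp)).trans h0))) hv₃ ?_
    intro s₄ v₄ hv₄ c₄ m₄ f₄
    have f := ((f₁.trans f₂).trans f₃).trans f₄
    refine ⟨⟨hv₄, fun r j hj => ?_, i' + 1, by omega,
      (e0.trans (f.mono (by simp) le_rfl)).mono le_rfl (by omega)⟩, ?_⟩
    · rcases Nat.eq_or_lt_of_le hj with hj | hj
      · have hjj : j = ⟨i, hiw⟩ := Fin.ext hj.symm
        subst hjj
        fin_cases r
        · exact m₄ _ _ (m₃ _ _ (m₂ _ _ c₁))
        · exact m₄ _ _ (m₃ _ _ c₂)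
        · exact m₄ _ _ c₃
        · exact c₄
      · exact m₄ _ _ (m₃ _ _ (m₂ _ _ (m₁ _ _ (hc r j hj))))
    · rw [f.reg _ (by simp), h0]
  · rw [e22]
    refine ⟨hv, fun r j hj => absurd j.2 (by omega), 0, by omega,
      (Eff.refl _ s).set (by simp) _⟩

/-- The factor `K o` is the value of the continuation after outcome `o`. The search is verified by a
fresh evaluation of the predicate, so outcome `true` is possible only if something is marked. -/
theorem wp_flag {mat : Bool} (hw : 0 < w) (h6 : s.reg 6 = 0) {C : Finset (Basis 4 w)}
    {a b : ℂ} (K : Bool → ℝ)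
    (hψ : s.psi = blend C
      (marked (ans₁ mat O (s.arr 1)) (ans₂ mat O (s.arr 1)) 2 3 ⟨0, hw⟩) a b)
    {t : ℕ} (ht : t = (C.filter fun x =>
      marked (ans₁ mat O (s.arr 1)) (ans₂ mat O (s.arr 1)) 2 3 ⟨0, hw⟩ x).card)
    (hv : v ≤ (C.card - t) * ‖b‖ ^ 2 * K false + t * ‖a‖ ^ 2 * K true)
    (hΦ : ∀ s' v' o, v' ≤ normSq s'.psi * K o → (o = true → 0 < t) →
      s'.reg 20 = (if o then 1 else s.reg 20) → Eff {20, 23, 24} 5 s s' → Φ s' v') :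
    Wp O (flag mat) s v Φ := by
  refine wp_seq (wp_ask₁ (wp_seq (wp_ask₂ (wp_seq ?_))))
  simp only [St.quant_arr, St.quant_psi]
  set s₁ := (s.quant _).quant (applyXor (ans₂ mat O (s.arr 1)) 3
    (applyXor (ans₁ mat O (s.arr 1)) 2 s.psi)) with hs₁
  have e₁ : Eff {20, 23, 24} 2 s s₁ := ((Eff.refl _ s).quant _).quant _
  have h6' : s₁.reg 6 = 0 := h6
  have h6'' : s₁.reg 6 < w := by omega
  have hn : ∀ o, normSq (project 3 ⟨s₁.reg 6, h6''⟩ o s₁.psi) =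
      if o then t * ‖a‖ ^ 2 else (C.card - t) * ‖b‖ ^ 2 := fun o => by
    rw [show (⟨s₁.reg 6, h6''⟩ : Fin w) = ⟨0, hw⟩ from Fin.ext h6', hs₁, St.quant_psi]
    rw [normSq_flag (indep_ans₁ _ _ _) (indep_ans₂ _ _ _), hψ, sum_marked_blend, ht]
  refine wp_meas h6'' ((C.card - t) * ‖b‖ ^ 2 * K false) (t * ‖a‖ ^ 2 * K true) hv (.inr ?_) ?_
  · refine wp_ite (fun h => absurd ?_ h) fun _ => wp_skip ?_
    · simp [St.measured_reg]
    · refine hΦ _ _ false ?_ (by simp) ?_ (((e₁.measured (y := 23) (by simp) _ _).tick).set (x := 24) (by simp) _)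
      · simp only [St.set_psi, St.tick_psi, St.measured_psi]
        rw [hn]; simp
      · simp [St.set_reg, St.measured_reg, hs₁]
  -- Without marked elements outcome `1` has amplitude zero and its branch is abandoned; there are
  -- no false positives.
  · rcases Nat.eq_zero_or_pos t with h0 | h0
    · left
      refine ⟨normSq_eq_zero ?_, by simp [h0]⟩
      rw [hn]; simp [h0]
    · right
      refine wp_ite (fun _ => wp_const ?_) fun h => absurd h ?_
      · refine hΦ _ _ true ?_ (fun _ => h0) ?_
          (((e₁.measured (y := 23) (by simp) _ _).tick).set (x := 20) (by simp) _)
        · simp only [St.set_psi, St.tick_psi, St.measured_psi]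
          rw [hn]; simp
        · simp [St.set_reg, one_mod_two_pow hw]
      · simp [St.measured_reg, one_mod_two_pow hw]

/-- The basis state in which register `0` holds `a` and the other registers hold `0`. -/
def base (w a : ℕ) : Basis 4 w := xorReg (fun _ _ => false) 0 a

theorem base_of_ne (a : ℕ) {r : Fin 4} (hr : r ≠ 0) (i : Fin w) : base w a r i = false := by
  rw [base, xorReg_apply_of_ne _ _ hr]

theorem regVal_base {a : ℕ} (ha : a < 2 ^ w) : regVal (base w a) 0 = a :=
  regVal_xorReg_self ha fun _ => rfl

/-- The basis states among which the search for a neighbour of `a` takes place. -/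
abbrev space (w a h : ℕ) : Finset (Basis 4 w) := cube (base w a) 1 (2 * h)

abbrev isHit (mat : Bool) (O : ℕ → ℕ → ℕ) (A : ℕ → ℕ) (hw : 0 < w) : Basis 4 w → Bool :=
  marked (ans₁ mat O A) (ans₂ mat O A) 2 3 ⟨0, hw⟩

/-- The number of basis states that are searched for. -/
def hits (mat : Bool) (O : ℕ → ℕ → ℕ) (A : ℕ → ℕ) (hw : 0 < w) (a h : ℕ) : ℕ :=
  ((space w a h).filter fun b => isHit mat O A hw b).card

theorem sqrt_two_pow_two_mul (h : ℕ) : (Real.sqrt 2 : ℂ) ^ (2 * h) = 2 ^ h := by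
  rw [pow_mul, sq, sqrt_two_sq]

theorem sqrt_two_pow (h : ℕ) : √((2 : ℝ) ^ (2 * h)) = 2 ^ h := by
  rw [mul_comm, pow_mul, Real.sqrt_sq (by positivity)]

/-- The uniform superposition has equal amplitudes on both parts, whatever the marking is; `m` and
`t` are therefore free and can be chosen to fit the iterations that follow. -/
theorem hads_base {a h : ℕ} (hl : 2 * h ≤ w) (m : Basis 4 w → Bool) (c : ℂ) (t : ℝ) :
    hads 1 (2 * h) (c • ket (base w a)) = blend (space w a h) m
      (c * (groverAmp t (2 ^ (2 * h)) 0).1) (c * (groverAmp t (2 ^ (2 * h)) 0).2) := by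
  funext b
  rw [map_smul, Pi.smul_apply, hads_ket 1 hl fun i _ => base_of_ne a (by decide) i, blend,
    sqrt_two_pow_two_mul, groverAmp, Function.iterate_zero, id, sqrt_two_pow]
  push_cast
  split_ifs <;> simp

/-- `K₀` and `K₁` are the values of the continuation after a failed and a successful trial. If
something is marked, a trial succeeds with probability at least `1/4`, which gains a quarter of the
difference. -/
theorem wp_trial {mat : Bool} (hw : 0 < w) {h a : ℕ} (hl : 2 * h ≤ w) (h1 : s.reg 1 = 1)
    (h2 : s.reg 2 = w) (h6 : s.reg 6 = 0) (h10 : s.reg 10 = h) (h11 : s.reg 11 = 2 * h)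
    (hA2 : s.arr 2 0 = a) (hA : s.arr 3 0 = 1) (hA' : ∀ x, x ≠ 0 → s.arr 3 x = 0)
    (α : ℂ) (hψ : s.psi = α • zeroState) {t : ℕ} (ht : hits mat O (s.arr 1) hw a h = t)
    (ht2 : 2 * t ≤ 2 ^ (2 * h)) {K₀ K₁ : ℝ} (hK : K₀ ≤ K₁)
    (hv : v ≤ ‖α‖ ^ 2 * (K₀ + if 0 < t then (K₁ - K₀) / 4 else 0))
    (hΦ : ∀ s' v' (α' : ℂ) (o : Bool), s'.psi = α' • zeroState →
      v' ≤ ‖α'‖ ^ 2 * (if o then K₁ else K₀) → (o = true → 0 < t) →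
      s'.reg 20 = (if o then 1 else s.reg 20) →
      Eff {20, 21, 22, 23, 24} (2 ^ h * (12 * h + 20) + 14 * h + 14 * w + 14) s s' → Φ s' v') :
    Wp O (trial mat) s v Φ := by
  have hlw : 2 * h < 2 ^ w := hl.trans_lt Nat.lt_two_pow_self
  set N : ℝ := 2 ^ (2 * h) with hN
  have hNp : 0 < N := by positivity
  have hNM : N = ((2 ^ h : ℕ) : ℝ) ^ 2 := by push_cast; rw [hN, mul_comm, pow_mul]
  set A := s.arr 1 with hAdef
  set C := space w a h with hC
  set m := isHit mat O A hw with hm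
  have hcard : (C.card : ℝ) = N := by rw [hC, card_cube _ _ hl]; push_cast; rfl
  -- The expected value of the continuation when exactly `j` iterations are made.
  set V : ℕ → ℝ := fun j => (C.card - t) * (groverAmp t N j).2 ^ 2 * K₀ +
    t * (groverAmp t N j).1 ^ 2 * K₁ with hV
  have hVeq : ∀ j, V j = K₀ + t * (groverAmp t N j).1 ^ 2 * (K₁ - K₀) := fun j => by
    have := groverAmp_norm (t := t) hNp j
    simp only [hV, hcard]
    linear_combination K₀ * this
  have hsum : (K₀ + if 0 < t then (K₁ - K₀) / 4 else 0) * 2 ^ h ≤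
      ∑ j ∈ Finset.range (2 ^ h), V j := by
    simp only [hVeq, Finset.sum_add_distrib, Finset.sum_const, Finset.card_range, nsmul_eq_mul,
      ← Finset.sum_mul]
    split_ifs with h0
    · have := sum_groverAmp_ge (t := t) (N := N) (M := 2 ^ h) (by exact_mod_cast h0)
        (by rw [hN]; exact_mod_cast ht2) hNM
      push_cast at this ⊢
      nlinarith
    · obtain rfl : t = 0 := by omega
      push_cast
      simp [mul_comm]
  refine wp_seq (wp_coins (h := h) (by omega) h1 h6 h10 α hψ V ?_ ?_)
  · calc v * 2 ^ h ≤ ‖α‖ ^ 2 * (K₀ + if 0 < t then (K₁ - K₀) / 4 else 0) * 2 ^ h :=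
        mul_le_mul_of_nonneg_right hv (by positivity)
      _ = ‖α‖ ^ 2 * ((K₀ + if 0 < t then (K₁ - K₀) / 4 else 0) * 2 ^ h) := by ring
      _ ≤ _ := mul_le_mul_of_nonneg_left hsum (by positivity)
  intro s₁ v₁ c j hp₁ hj hjh hv₁ f₁
  have hX : ({21, 22, 23, 24} : Set ℕ) ⊆ {20, 21, 22, 23, 24} := by simp
  have hX22 : ({22} : Set ℕ) ⊆ {20, 21, 22, 23, 24} := by simp
  have g₁ := (f₁.mono hX le_rfl).quant (applyXor (fun b => s₁.arr 2 (regVal b 1)) 0 s₁.psi)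
  refine wp_seq (wp_lookup (by decide) (wp_seq (wp_hadsProg hlw ?_ ?_ ?_ ?_)))
  · rw [g₁.reg _ (by simp), h1]
  · rw [g₁.reg _ (by simp), h6]
  · rw [g₁.reg _ (by simp), h11]
  intro s₂ hp₂ f₂
  have hbase : xorPerm (fun b => s₁.arr 2 (regVal b 1)) 0 (fun _ _ => false) = base w a := by
    rw [xorPerm, base, regVal_zero fun _ => rfl, f₁.arr, hA2]
  simp only [St.quant_psi] at hp₂
  rw [hp₁, zeroState_eq_ket, applyXor_ket (indep_one _ (by decide)), hbase,
    hads_base hl m c t] at hp₂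
  have g₂ := g₁.trans (f₂.mono hX22 le_rfl)
  have e21 : s₂.reg 21 = j := by rw [f₂.reg _ (by simp), St.quant_reg, hj]
  refine wp_seq (wp_down (fun i s' v' => v' = v₁ ∧ ∃ i', i' + i = j ∧
    s'.psi = blend C m (c * (groverAmp t N i').1) (c * (groverAmp t N i').2) ∧
    s'.reg 20 = s.reg 20 ∧
    Eff {20, 21, 22, 23, 24} (14 * h + 6 + (12 * h + 20) * i') s s') ?_ ?_ ?_ ?_)
  · rintro s₃ v₃ ⟨rfl, i', hi', hp₃, h20, f₃⟩ hx
    obtain rfl : i' = j := hi'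
    have a₃ : s₃.tick.arr 1 = A := by rw [St.tick_arr, f₃.arr]
    refine wp_seq (wp_flag hw ?_ (fun o => if o then K₁ else K₀) (C := C) (t := t)
      (a := c * (groverAmp t N i').1) (b := c * (groverAmp t N i').2) ?_ ?_ ?_ ?_)
    · rw [St.tick_reg, f₃.reg _ (by simp), h6]
    · rw [a₃, St.tick_psi, hp₃]
    · rw [a₃, ← ht]; rfl
    · refine hv₁.trans_eq ?_
      simp only [hV, norm_mul, mul_pow, Complex.norm_real, Real.norm_eq_abs, sq_abs]
      simp
      ring
    · intro s₄ v₄ o hv₄ ho h20₄ f₄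
      have g₄ := f₃.tick.trans (f₄.mono (Y := {20, 21, 22, 23, 24})
        (by simp [Set.insert_subset_iff]) le_rfl)
      refine wp_reset ?_ ?_ ?_ hv₄ ?_
      · rw [g₄.reg _ (by simp), h1]
      · rw [g₄.reg _ (by simp), h2]
      · rw [g₄.reg _ (by simp), h6]
      · intro s₅ v₅ α₅ hp₅ hv₅ f₅
        refine hΦ s₅ v₅ α₅ o hp₅ hv₅ ho ?_ ((g₄.trans (f₅.mono
          (by simp [Set.insert_subset_iff]) le_rfl)).mono le_rfl ?_)
        · rw [f₅.reg _ (by simp), h20₄, St.tick_reg, h20]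
        · have : (12 * h + 20) * i' ≤ 2 ^ h * (12 * h + 20) := by
            rw [mul_comm]; exact Nat.mul_le_mul_right _ hjh.le
          omega
  · rintro i s₃ v₃ ⟨rfl, i', hi', hp₃, h20, f₃⟩ hx hi
    refine ⟨by rw [f₃.reg _ (by simp), h1], ?_⟩
    have g₃ := f₃.tick.set (x := 21) (by simp) i
    have a₃ : (s₃.tick.set 21 i).arr = s.arr := by rw [g₃.arr]
    have hz : ∀ r : Fin 4, r ≠ 0 → ∀ i, base w a r i = false := fun r hr i => base_of_ne a hr i
    refine wp_iteration (z := base w a) hw hl ?_ ?_ ?_ hz ?_ ?_ c (groverAmp t N i') ?_ ?_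
    · rw [g₃.reg _ (by simp), h1]
    · rw [g₃.reg _ (by simp), h6]
    · rw [g₃.reg _ (by simp), h11]
    · rw [a₃, hA]
    · rw [a₃]; exact hA'
    · rw [a₃, St.set_psi, St.tick_psi, hp₃]
    · intro s₄ hp₄ f₄
      rw [a₃] at hp₄
      refine ⟨⟨rfl, i' + 1, by omega, ?_, ?_, (g₃.trans (f₄.mono hX22 le_rfl)).mono le_rfl ?_⟩, ?_⟩
      · rw [hp₄, groverAmp_succ, ← ht]; rfl
      · rw [f₄.reg _ (by simp), St.set_reg, if_neg (by norm_num), St.tick_reg, h20]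
      · rw [mul_add]; omega
      · rw [f₄.reg _ (by simp), St.set_reg, if_pos rfl, Nat.mod_eq_of_lt hi]
  · rw [e21]
    exact hjh.trans (Nat.pow_lt_pow_right (by norm_num) (by omega))
  · rw [e21]
    refine ⟨rfl, 0, by omega, hp₂, ?_, g₂.mono le_rfl (by omega)⟩
    rw [f₂.reg _ (by simp), St.quant_reg, f₁.reg _ (by simp)]

/-! ### The searched predicate and repeated trials -/

/-- The predicate that is searched for, in terms of the index `x`. -/
def hit (mat : Bool) (O : ℕ → ℕ → ℕ) (A : ℕ → ℕ) (a x : ℕ) : Bool :=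
  (if mat then O a (A x) else A (O a x)).testBit 0

/-- The answer registers are `0` on the search space, so the exclusive or operations simply write
the answers; the size bounds exclude truncation of the intermediate one. -/
theorem isHit_iff {mat : Bool} {A : ℕ → ℕ} (hw : 0 < w) {a h : ℕ} (ha : a < 2 ^ w)
    (hO : ∀ i j, O i j < 2 ^ w) (hA : ∀ x, A x < 2 ^ w) {b : Basis 4 w}
    (hb : b ∈ space w a h) : isHit mat O A hw b = hit mat O A a (regVal b 1) := by
  rw [mem_cube] at hb
  have h0 : regVal b 0 = a := by rw [← regVal_base ha, regVal, regVal, hb.1 0 (by decide)]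
  have h2 : ∀ i, b 2 i = false := fun i => by
    rw [hb.1 2 (by decide)]; exact base_of_ne a (by decide) i
  have h3 : ∀ i, b 3 i = false := fun i => by
    rw [hb.1 3 (by decide)]; exact base_of_ne a (by decide) i
  rw [isHit, marked, xorPerm, xorReg_apply_self, xorPerm, xorReg_apply_of_ne _ _ (by decide), h3,
    Bool.false_xor, hit, ans₂, ans₁]
  cases mat
  · simp only [Bool.false_eq_true, if_false]
    rw [regVal_xorReg_self (hO _ _) h2, h0]
  · simp only [if_true]
    rw [regVal_xorReg_self (hA _) h2, regVal_xorReg_of_ne _ _ (by decide), h0]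

theorem regVal_injOn_space (a h : ℕ) :
    Set.InjOn (fun b : Basis 4 w => regVal b 1) (space w a h) := by
  intro b hb b' hb' hbb
  rw [Finset.mem_coe, mem_cube] at hb hb'
  funext r
  by_cases hr : r = 1
  · subst hr; exact regVal_inj hbb
  · rw [hb.1 r hr, hb'.1 r hr]

theorem hits_le {mat : Bool} {A : ℕ → ℕ} (hw : 0 < w) {a h d : ℕ} (ha : a < 2 ^ w)
    (hO : ∀ i j, O i j < 2 ^ w) (hA : ∀ x, A x < 2 ^ w)
    (hd : ∀ x, hit mat O A a x = true → 1 ≤ x ∧ x ≤ d) : hits mat O A hw a h ≤ d := by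
  rw [hits, ← Nat.add_sub_cancel (n := d) (m := 1), ← Nat.card_Icc]
  refine Finset.card_le_card_of_injOn (fun b => regVal b 1) (fun b hb => ?_)
    ((regVal_injOn_space a h).mono fun b hb => ?_)
  · have hb' := Finset.mem_filter.1 (Finset.mem_coe.1 hb)
    rw [isHit_iff hw ha hO hA hb'.1] at hb'
    exact Finset.mem_coe.2 (Finset.mem_Icc.2 (hd _ hb'.2))
  · exact (Finset.mem_filter.1 (Finset.mem_coe.1 hb)).1

/-- All hits are indices of at most `d < 2 ^ (2 * h)`, so the restriction to `2 * h` index qubits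
loses none of them. -/
theorem hits_pos_iff {mat : Bool} {A : ℕ → ℕ} (hw : 0 < w) {a h d : ℕ} (ha : a < 2 ^ w)
    (hl : 2 * h ≤ w) (hO : ∀ i j, O i j < 2 ^ w) (hA : ∀ x, A x < 2 ^ w)
    (hd : ∀ x, hit mat O A a x = true → 1 ≤ x ∧ x ≤ d) (hdh : d < 2 ^ (2 * h)) :
    0 < hits mat O A hw a h ↔ ∃ x, hit mat O A a x = true := by
  rw [hits, Finset.card_pos]
  constructor
  · rintro ⟨b, hb⟩
    have hb' := Finset.mem_filter.1 hb
    rw [isHit_iff hw ha hO hA hb'.1] at hb'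
    exact ⟨_, hb'.2⟩
  · rintro ⟨x, hx⟩
    have hxh : x < 2 ^ (2 * h) := (hd x hx).2.trans_lt hdh
    have hxw : x < 2 ^ w := hxh.trans_le (Nat.pow_le_pow_right (by norm_num) hl)
    have hmem : xorReg (base w a) 1 x ∈ space w a h := by
      rw [mem_cube]
      refine ⟨fun r hr => xorReg_apply_of_ne _ _ hr, fun i hi => ?_⟩
      rw [xorReg_apply_self, Nat.testBit_lt_two_pow
        (hxh.trans_le (Nat.pow_le_pow_right (by norm_num) hi)), Bool.xor_false]
    refine ⟨_, Finset.mem_filter.2 ⟨hmem, ?_⟩⟩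
    rw [isHit_iff hw ha hO hA hmem, regVal_xorReg_self hxw (base_of_ne a (by decide))]
    exact hx

def trials (mat : Bool) : Prog 4 := .seq (.op .add 13 2 6) (.down 13 1 (trial mat))

theorem wp_trials {mat : Bool} (hw : 0 < w) {h a : ℕ} (hl : 2 * h ≤ w) (h1 : s.reg 1 = 1)
    (h2 : s.reg 2 = w) (h6 : s.reg 6 = 0) (h10 : s.reg 10 = h) (h11 : s.reg 11 = 2 * h)
    (h20 : s.reg 20 = 0)
    (hA2 : s.arr 2 0 = a) (hA : s.arr 3 0 = 1) (hA' : ∀ x, x ≠ 0 → s.arr 3 x = 0)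
    (α : ℂ) (hψ : s.psi = α • zeroState) {t : ℕ} (ht : hits mat O (s.arr 1) hw a h = t)
    (ht2 : 2 * t ≤ 2 ^ (2 * h)) {K : ℝ} (hK : 0 ≤ K)
    (hv : v ≤ ‖α‖ ^ 2 * (K * (1 - (3 / 4) ^ w)))
    (hΦ : ∀ s' v' (α' : ℂ) (o : Bool), s'.psi = α' • zeroState →
      v' ≤ 0 ∨ (o = true ↔ 0 < t) ∧ v' ≤ ‖α'‖ ^ 2 * K →
      s'.reg 20 = (if o then 1 else 0) →
      Eff {13, 20, 21, 22, 23, 24}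
        (w * (2 ^ h * (12 * h + 20) + 14 * h + 14 * w + 16) + 2) s s' → Φ s' v') :
    Wp O (trials mat) s v Φ := by
  have hww : w < 2 ^ w := Nat.lt_two_pow_self
  refine wp_seq (wp_op ?_)
  have e : s.set 13 (BinOp.eval .add (s.reg 2) (s.reg 6)) = s.set 13 w := by
    rw [h2, h6]; rfl
  rw [e]
  have e13 : (s.set 13 w).reg 13 = w := by rw [St.set_reg, if_pos rfl, Nat.mod_eq_of_lt hww]
  set T := 2 ^ h * (12 * h + 20) + 14 * h + 14 * w + 14 with hT
  -- The value of a state with `i` trials left and current result `o`. It is below `K` only when a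
  -- hit exists and has not been found, and then a further trial multiplies the deficit by `3/4`.
  set κ : ℕ → Bool → ℝ := fun i o =>
    if 0 < t ∧ o = false then K * (1 - (3 / 4) ^ i) else K with hκ
  have hκt : ∀ i, κ i true = K := fun i => by simp [hκ]
  have hκ_le : ∀ i o, κ i o ≤ K := fun i o => by
    simp only [hκ]
    split_ifs
    · have : (0 : ℝ) ≤ (3 / 4) ^ i := by positivity
      nlinarith
    · exact le_rfl
  refine wp_down (fun i s' v' => ∃ (α' : ℂ) (o : Bool), s'.psi = α' • zeroState ∧
    (o = true → 0 < t) ∧ s'.reg 20 = (if o then 1 else 0) ∧ v' ≤ ‖α'‖ ^ 2 * κ i o ∧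
    ∃ i', i' + i = w ∧ Eff {13, 20, 21, 22, 23, 24} (1 + (T + 2) * i') s s') ?_ ?_
    (by rw [e13]; exact hww) ?_
  · rintro s' v' ⟨α', o, hp, ho, h20', hv', i', hi', he⟩ hx
    obtain rfl : i' = w := hi'
    refine hΦ _ v' α' o hp ?_ h20' (he.tick.mono le_rfl ?_)
    -- With no trials left, a missed hit has value `0`; thus a wrong result comes with weight at
    -- most `0`.
    · simp only [hκ, pow_zero, sub_self, mul_zero] at hv'
      cases o
      · by_cases h0 : 0 < t
        · exact .inl (by simpa [h0] using hv')
        · exact .inr ⟨by simp [h0], by simpa [h0] using hv'⟩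
      · exact .inr ⟨by simp [ho rfl], by simpa using hv'⟩
    · have : (T + 2) * i' = i' * (2 ^ h * (12 * h + 20) + 14 * h + 14 * i' + 16) := by
        rw [hT]; ring
      omega
  · rintro i s' v' ⟨α', o, hp, ho, h20', hv', i', hi', he⟩ hx hi
    refine ⟨by rw [he.reg _ (by simp), h1], ?_⟩
    have g := he.tick.set (x := 13) (by simp) i
    refine wp_trial hw (h := h) (a := a) hl ?_ ?_ ?_ ?_ ?_ ?_ ?_ ?_ α' hp (t := t) ?_ ht2
      (K₀ := κ i o) (K₁ := K) (hκ_le i o) (hv'.trans ?_) ?_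
    · rw [g.reg _ (by simp), h1]
    · rw [g.reg _ (by simp), h2]
    · rw [g.reg _ (by simp), h6]
    · rw [g.reg _ (by simp), h10]
    · rw [g.reg _ (by simp), h11]
    · rw [g.arr, hA2]
    · rw [g.arr, hA]
    · rw [g.arr]; exact hA'
    · rw [g.arr, ht]
    · refine mul_le_mul_of_nonneg_left ?_ (by positivity)
      simp only [hκ]
      split_ifs with hc h0 h0
      · rw [pow_succ]; linarith
      · exact absurd hc.1 h0
      · linarith
      · linarith
    · intro s'' v'' α'' o' hp'' hv'' ho' h20'' f
      have f' : Eff {13, 20, 21, 22, 23, 24} T (s'.tick.set 13 i) s'' :=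
        f.mono (by simp) le_rfl
      refine ⟨⟨α'', o || o', hp'', ?_, ?_, ?_, i' + 1, by omega, (g.trans f').mono le_rfl ?_⟩, ?_⟩
      · intro h'
        rcases (Bool.or_eq_true _ _).mp h' with h' | h'
        · exact ho h'
        · exact ho' h'
      · have e20 : (s'.tick.set 13 i).reg 20 = s'.reg 20 := by simp [St.set_reg]
        rw [h20'', e20, h20']
        cases o <;> cases o' <;> rfl
      · refine hv''.trans_eq ?_
        cases o <;> cases o' <;> simp [hκt]
      · rw [mul_add]; omega
      · rw [f.reg _ (by simp), St.set_reg, if_pos rfl, Nat.mod_eq_of_lt hi]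
  · rw [e13]
    refine ⟨α, false, hψ, by simp, ?_, hv.trans ?_, 0, by omega,
      (Eff.refl _ s).set (by simp) _⟩
    · rw [St.set_reg, if_neg (by norm_num), h20]; rfl
    · refine mul_le_mul_of_nonneg_left ?_ (by positivity)
      simp only [hκ]
      split_ifs
      · exact le_rfl
      · have : (0 : ℝ) ≤ (3 / 4) ^ w := by positivity
        nlinarith

/-- Compute the least `h` with `2 * R[5] < 4 ^ h`. -/
def sizes : Prog 4 :=
  .seq (.const 10 0) (.seq (.op .add 12 5 5) (.seq
    (.loop 12 (.seq (.op .div 12 12 8) (.op .add 10 10 1))) (.op .add 11 10 10)))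

/-- The upper bound on `4 ^ h` expresses minimality of `h`; for `h = 0` it needs `0 < d`. -/
theorem wp_sizes {d : ℕ} (h1 : s.reg 1 = 1) (h5 : s.reg 5 = d) (h8 : s.reg 8 = 4) (hd : 0 < d)
    (hdw : 8 * d < 2 ^ w)
    (hΦ : ∀ s' h, s'.reg 10 = h → s'.reg 11 = 2 * h → 2 * d < 4 ^ h → 4 ^ h ≤ 8 * d →
      s'.psi = s.psi → Eff {10, 11, 12} (3 * h + 4) s s' → Φ s' v) :
    Wp O sizes s v Φ := by
  -- No overflow: from `i < 2 ^ i` follows `2 * i ≤ 4 ^ i`.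
  have hiw : ∀ i, 4 ^ i ≤ 8 * d → 2 * i < 2 ^ w := fun i hi => by
    have h1 : i + i < 2 ^ i * 2 ^ i + 1 := by
      have := Nat.lt_two_pow_self (n := i)
      nlinarith
    have h2 : (4 : ℕ) ^ i = 2 ^ i * 2 ^ i := by rw [← mul_pow]; norm_num
    omega
  refine wp_seq (wp_const (wp_seq (wp_op (wp_seq ?_))))
  refine wp_loop (fun s' v' => v' = v ∧ ∃ i, s'.reg 10 = i ∧ s'.reg 12 = 2 * d / 4 ^ i ∧
    4 ^ i ≤ 8 * d ∧ s'.psi = s.psi ∧ Eff {10, 11, 12} (3 * i + 2) s s') (fun s' => s'.reg 12)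
    ?_ ?_ ?_
  · rintro s' v' ⟨rfl, i, h10, h12, hi, hp, he⟩ hx
    refine wp_op (hΦ _ i ?_ ?_ ?_ hi hp ((he.tick.set (by simp) _).mono le_rfl (by omega)))
    · simp [St.set_reg, h10]
    · have := hiw i hi
      simp only [St.set_reg, if_true, St.tick_reg, BinOp.eval, h10]
      rw [Nat.mod_eq_of_lt (by omega)]; ring
    · rw [h12] at hx
      exact (Nat.div_eq_zero_iff.1 hx).resolve_left (by positivity)
  · rintro s' v' ⟨rfl, i, h10, h12, hi, hp, he⟩ hx
    have hx' : 0 < 2 * d / 4 ^ i := by omega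
    have h4 : 4 ^ i ≤ 2 * d := (Nat.div_pos_iff.1 hx').2
    have hi' : 4 ^ (i + 1) ≤ 8 * d := by rw [pow_succ]; omega
    have hlt := hiw _ hi'
    have hdiv : 2 * d / 4 ^ i / 4 = 2 * d / 4 ^ (i + 1) := by rw [Nat.div_div_eq_div_mul, pow_succ]
    have hle : 2 * d / 4 ^ (i + 1) ≤ 2 * d := Nat.div_le_self _ _
    have h8' : s'.reg 8 = 4 := by rw [he.reg _ (by simp), h8]
    have h1' : s'.reg 1 = 1 := by rw [he.reg _ (by simp), h1]
    refine wp_seq (wp_op (wp_op ⟨⟨rfl, i + 1, ?_, ?_, hi', hp,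
      ((he.tick.set (by simp) _).set (by simp) _).mono le_rfl (by omega)⟩, ?_⟩))
    · simp only [St.set_reg, St.tick_reg, BinOp.eval, h10, h1']
      norm_num
      exact Nat.mod_eq_of_lt (by omega)
    · simp only [St.set_reg, St.tick_reg, BinOp.eval, h12, h8', hdiv]
      norm_num
      exact Nat.mod_eq_of_lt (by omega)
    · simp only [St.set_reg, St.tick_reg, BinOp.eval, h12, h8']
      norm_num
      rw [Nat.mod_eq_of_lt (by omega)]
      exact Nat.div_lt_self hx' (by norm_num)
  · refine ⟨rfl, 0, ?_, ?_, by simp; omega, rfl,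
      (((Eff.refl _ s).set (by simp) _).set (by simp) _)⟩
    · simp [St.set_reg]
    · simp only [St.set_reg, BinOp.eval, h5]
      norm_num
      rw [Nat.mod_eq_of_lt (by omega)]; ring

def search (mat : Bool) : Prog 4 := .seq (.store 2 6 4) (.seq sizes (trials mat))

/-- A bound for the cost of a search among `d` elements. -/
def searchCost (w d : ℕ) : ℕ := 40 * (Nat.sqrt (8 * d) * w ^ 2)

/-- The dominant term comes from `w` trials of `2 ^ h ≤ M` iterations with `O(w)` gates each. The
final `+ 1` pays for the store that precedes the search. -/
theorem trials_cost_le {h M : ℕ} (hw : 10 ≤ w) (hl : 2 * h ≤ w) (hM : 2 ^ h ≤ M) :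
    (3 * h + 4) + (w * (2 ^ h * (12 * h + 20) + 14 * h + 14 * w + 16) + 2) + 1 ≤
      40 * (M * w ^ 2) := by
  have hM1 : 1 ≤ M := Nat.one_le_two_pow.trans hM
  have k1 : 2 ^ h * (12 * h + 20) ≤ M * (8 * w) := Nat.mul_le_mul hM (by omega)
  have k2 : 14 * h + 14 * w + 16 ≤ M * (23 * w) :=
    le_trans (by omega) (Nat.le_mul_of_pos_left _ hM1)
  have k3 : w * (2 ^ h * (12 * h + 20) + 14 * h + 14 * w + 16) ≤ 31 * (M * w ^ 2) := by
    calc _ ≤ w * (M * (8 * w) + M * (23 * w)) := Nat.mul_le_mul_left _ (by omega)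
      _ = _ := by ring
  have k4 : w * 1 * 10 ≤ M * w ^ 2 := by
    calc w * 1 * 10 ≤ w * M * w := Nat.mul_le_mul (Nat.mul_le_mul_left _ hM1) hw
      _ = _ := by ring
  omega

/-- `Eff` demands unchanged arrays, so it is stated from the state after the vertex has been stored
in `A_2[0]`; the operation spent on this store is deducted from the cost. -/
theorem wp_search {mat : Bool} (hw : 10 ≤ w) {a d : ℕ} (h1 : s.reg 1 = 1)
    (h2 : s.reg 2 = w) (h4 : s.reg 4 = a) (h5 : s.reg 5 = d) (h6 : s.reg 6 = 0)
    (h8 : s.reg 8 = 4) (h20 : s.reg 20 = 0)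
    (hd0 : 0 < d) (hdw : 8 * d < 2 ^ w) (haw : a < 2 ^ w)
    (hA : s.arr 3 0 = 1) (hA' : ∀ x, x ≠ 0 → s.arr 3 x = 0)
    (hO : ∀ i j, O i j < 2 ^ w) (hA1 : ∀ x, s.arr 1 x < 2 ^ w)
    (hd : ∀ x, hit mat O (s.arr 1) a x = true → 1 ≤ x ∧ x ≤ d)
    (α : ℂ) (hψ : s.psi = α • zeroState) {K : ℝ} (hK : 0 ≤ K)
    (hv : v ≤ ‖α‖ ^ 2 * (K * (1 - (3 / 4) ^ w)))
    (hΦ : ∀ s' v' (α' : ℂ) (o : Bool), s'.psi = α' • zeroState →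
      v' ≤ 0 ∨ (o = true ↔ ∃ x, hit mat O (s.arr 1) a x = true) ∧ v' ≤ ‖α'‖ ^ 2 * K →
      s'.reg 20 = (if o then 1 else 0) →
      Eff {10, 11, 12, 13, 20, 21, 22, 23, 24} (searchCost w d - 1) (s.put 2 0 a) s' →
      1 ≤ searchCost w d → Φ s' v') :
    Wp O (search mat) s v Φ := by
  have hw0 : 0 < w := by omega
  refine wp_seq (wp_store (wp_seq ?_))
  rw [h4, h6]
  refine wp_sizes (d := d) h1 h5 h8 hd0 hdw ?_
  intro s₁ h h10 h11 hdh hhd hp₁ f₁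
  have h4h : (4 : ℕ) ^ h = 2 ^ (2 * h) := by rw [pow_mul]; norm_num
  have hl : 2 * h ≤ w := by
    refine (Nat.pow_lt_pow_iff_right (a := 2) (by norm_num)).1 ?_ |>.le
    omega
  have e1 : s₁.arr 1 = s.arr 1 := by
    rw [f₁.arr]; funext x; simp [St.put_arr]
  have e3 : s₁.arr 3 = s.arr 3 := by
    rw [f₁.arr]; funext x; simp [St.put_arr]
  have e2 : s₁.arr 2 0 = a := by rw [f₁.arr]; simp [St.put_arr]
  refine wp_trials hw0 (h := h) (a := a) hl ?_ ?_ ?_ h10 h11 ?_ e2 ?_ ?_ α (hp₁.trans hψ) rfl ?_ hK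
    hv ?_
  · rw [f₁.reg _ (by simp), St.put_reg, h1]
  · rw [f₁.reg _ (by simp), St.put_reg, h2]
  · rw [f₁.reg _ (by simp), St.put_reg, h6]
  · rw [f₁.reg _ (by simp), St.put_reg, h20]
  · rw [e3, hA]
  · rw [e3]; exact hA'
  · rw [e1]
    have := hits_le (mat := mat) hw0 (h := h) haw hO hA1 hd
    omega
  · intro s₂ v₂ α₂ o hp₂ hv₂ h20' f₂
    rw [e1, hits_pos_iff hw0 haw hl hO hA1 hd (by omega)] at hv₂
    have hM : 2 ^ h ≤ Nat.sqrt (8 * d) := by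
      rw [Nat.le_sqrt, ← mul_pow]; exact hhd
    have hcost := trials_cost_le hw hl hM
    rw [← searchCost] at hcost
    refine hΦ s₂ v₂ α₂ o hp₂ hv₂ h20' (((f₁.mono ?_ le_rfl).trans (f₂.mono ?_ le_rfl)).mono le_rfl ?_)
      ?_
    · simp [Set.insert_subset_iff]
    · simp [Set.insert_subset_iff]
    · omega
    · omega

/-! ### Processing one vertex -/

/-- Write the number of elements among which to search to register `5`. -/
def getDegree (mat : Bool) : Prog 4 := if mat then .op .add 5 0 6 else .load 5 0 4

/-- Put the current vertex into the independent set. -/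
def putVertex (mat : Bool) : Prog 4 := .store 1 4 (if mat then 4 else 1)

/-- The counter in register `3` has already been decremented, hence the `+ 1` for the vertex number.
The test of register `5` spares isolated vertices all quantum operations, without which `√(n * m)`
could not bound the quantum time. -/
def vertex (mat : Bool) : Prog 4 :=
  .seq (.op .add 4 3 1) (.seq (getDegree mat) (.seq (.const 20 0)
    (.seq (.ite 5 (search mat) skip) (.ite 20 skip (putVertex mat)))))

/-- The registers that hold constants. -/
structure Consts (n w : ℕ) (s : St 4 w) : Prop where
  r0 : s.reg 0 = n
  r1 : s.reg 1 = 1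
  r2 : s.reg 2 = w
  r6 : s.reg 6 = 0
  r8 : s.reg 8 = 4
  a0 : s.arr 3 0 = 1
  a1 : ∀ x, x ≠ 0 → s.arr 3 x = 0

theorem wp_vertex {mat : Bool} (hw : 10 ≤ w) {n i d : ℕ} (hc : Consts n w s)
    (h3 : s.reg 3 = i) (hi : i < n) (hn : 8 * n < 2 ^ w)
    (hO : ∀ i j, O i j < 2 ^ w) (hA1 : ∀ x, s.arr 1 x < 2 ^ w)
    (hdd : (if mat then n else s.arr 0 (i + 1)) = d) (hdn : d ≤ n)
    (hd : ∀ x, hit mat O (s.arr 1) (i + 1) x = true → 1 ≤ x ∧ x ≤ d)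
    (α : ℂ) (hψ : s.psi = α • zeroState) {K : ℝ} (hK : 0 ≤ K)
    (hv : v ≤ ‖α‖ ^ 2 * (K * (1 - (3 / 4) ^ w)))
    (hΦ : ∀ s' v' (α' : ℂ) (o : Bool), s'.psi = α' • zeroState →
      v' ≤ 0 ∨ (o = true ↔ ∃ x, hit mat O (s.arr 1) (i + 1) x = true) ∧
        v' ≤ ‖α'‖ ^ 2 * K →
      Consts n w s' → s'.reg 3 = i → s'.arr 0 = s.arr 0 →
      (∀ x, s'.arr 1 x =
        if o = false ∧ x = i + 1 then (if mat then i + 1 else 1) else s.arr 1 x) →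
      s'.time ≤ s.time + 7 + searchCost w d → s'.qtime ≤ s.qtime + searchCost w d → Φ s' v') :
    Wp O (vertex mat) s v Φ := by
  have hw0 : 0 < w := by omega
  set X : Set ℕ := {4, 5, 10, 11, 12, 13, 20, 21, 22, 23, 24} with hX
  have haw : i + 1 < 2 ^ w := by omega
  refine wp_seq (wp_op (wp_seq ?_))
  have e : s.set 4 (BinOp.eval .add (s.reg 3) (s.reg 1)) = s.set 4 (i + 1) := by
    rw [h3, hc.r1]; rfl
  rw [e]
  suffices H : Wp O (.seq (.const 20 0) (.seq (.ite 5 (search mat) skip)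
      (.ite 20 skip (putVertex mat)))) ((s.set 4 (i + 1)).set 5 d) v Φ by
    cases mat
    · refine wp_load ?_
      have e4 : (s.set 4 (i + 1)).reg 4 = i + 1 := by
        rw [St.set_reg, if_pos rfl, Nat.mod_eq_of_lt haw]
      rw [e4, St.set_arr]
      simp only [Bool.false_eq_true, if_false] at hdd
      rw [hdd]; exact H
    · refine wp_op ?_
      have e0 : BinOp.eval .add ((s.set 4 (i + 1)).reg 0) ((s.set 4 (i + 1)).reg 6) = d := by
        simp only [if_true] at hdd
        simp [St.set_reg, BinOp.eval, hc.r0, hc.r6, hdd]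
      rw [e0]; exact H
  refine wp_seq (wp_const (wp_seq ?_))
  set s₁ := ((s.set 4 (i + 1)).set 5 d).set 20 0 with hs₁
  have f₁ : Eff X 3 s s₁ := (((Eff.refl X s).set (by simp [hX]) _).set (by simp [hX]) _).set
    (by simp [hX]) _
  have q₁ : s₁.qtime = s.qtime := rfl
  have r4 : s₁.reg 4 = i + 1 := by simp [hs₁, St.set_reg, Nat.mod_eq_of_lt haw]
  have r5 : s₁.reg 5 = d := by
    simp [hs₁, St.set_reg, Nat.mod_eq_of_lt (show d < 2 ^ w by omega)]
  have r20 : s₁.reg 20 = 0 := by simp [hs₁, St.set_reg]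
  have key : ∀ s₂ v₂ (α' : ℂ) (o : Bool), s₂.psi = α' • zeroState →
      v₂ ≤ 0 ∨ (o = true ↔ ∃ x, hit mat O (s.arr 1) (i + 1) x = true) ∧
        v₂ ≤ ‖α'‖ ^ 2 * K →
      s₂.reg 20 = (if o then 1 else 0) → (∀ r, r ∉ X → s₂.reg r = s.reg r) →
      s₂.reg 4 = i + 1 → (∀ a, a ≠ 2 → s₂.arr a = s.arr a) →
      s₂.time ≤ s.time + 5 + searchCost w d → s₂.qtime ≤ s.qtime + searchCost w d →
      Wp O (.ite 20 skip (putVertex mat)) s₂ v₂ Φ := by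
    intro s₂ v₂ α' o hp₂ hv₂ h20 hr h4 ha ht hq
    have hc₂ : Consts n w s₂ := by
      refine ⟨?_, ?_, ?_, ?_, ?_, ?_, ?_⟩
      · rw [hr _ (by simp [hX]), hc.r0]
      · rw [hr _ (by simp [hX]), hc.r1]
      · rw [hr _ (by simp [hX]), hc.r2]
      · rw [hr _ (by simp [hX]), hc.r6]
      · rw [hr _ (by simp [hX]), hc.r8]
      · rw [ha 3 (by norm_num), hc.a0]
      · rw [ha 3 (by norm_num)]; exact hc.a1
    have hr3 : s₂.reg 3 = i := by rw [hr _ (by simp [hX]), h3]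
    refine wp_ite (fun h => wp_skip ?_) fun h => wp_store ?_
    · have ho : o = true := by
        cases o
        · simp [h20] at h
        · rfl
      refine hΦ _ _ α' o hp₂ hv₂ ⟨?_, ?_, ?_, ?_, ?_, hc₂.a0, hc₂.a1⟩ ?_ (ha 0 (by norm_num)) ?_ ?_
        ?_
      · simp [St.set_reg, hc₂.r0]
      · simp [St.set_reg, hc₂.r1]
      · simp [St.set_reg, hc₂.r2]
      · simp [St.set_reg, hc₂.r6]
      · simp [St.set_reg, hc₂.r8]
      · simp [St.set_reg, hr3]
      · intro x
        simp [ho, ha 1 (by norm_num)]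
      · simp only [St.set_time, St.tick_time]; omega
      · simpa using hq
    · have ho : o = false := by
        cases o
        · rfl
        · simp [h20] at h
      have hval : s₂.tick.reg (if mat then 4 else 1) = if mat then i + 1 else 1 := by
        cases mat
        · simp [hc₂.r1]
        · simp [h4]
      rw [hval, St.tick_reg, h4]
      refine hΦ _ _ α' o hp₂ hv₂ ⟨hc₂.r0, hc₂.r1, hc₂.r2, hc₂.r6, hc₂.r8, ?_, ?_⟩ hr3 ?_ ?_ ?_ ?_
      · rw [St.put_arr, if_neg (by simp), St.tick_arr, hc₂.a0]
      · intro x hx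
        rw [St.put_arr, if_neg (by simp), St.tick_arr, hc₂.a1 x hx]
      · funext x
        rw [St.put_arr, if_neg (by simp), St.tick_arr, ha 0 (by norm_num)]
      · intro x
        rw [St.put_arr, St.tick_arr, ha 1 (by norm_num)]
        simp [ho]
      · simp only [St.put_time, St.tick_time]; omega
      · simpa using hq
  refine wp_ite (fun h => ?_) fun h => wp_skip ?_
  · have hd0 : 0 < d := by omega
    refine wp_search hw (a := i + 1) (d := d) ?_ ?_ r4 r5 ?_ ?_ r20 hd0 (by omega) haw hc.a0 hc.a1
      hO hA1 hd α hψ hK hv ?_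
    · rw [St.tick_reg, f₁.reg _ (by simp [hX]), hc.r1]
    · rw [St.tick_reg, f₁.reg _ (by simp [hX]), hc.r2]
    · rw [St.tick_reg, f₁.reg _ (by simp [hX]), hc.r6]
    · rw [St.tick_reg, f₁.reg _ (by simp [hX]), hc.r8]
    · intro s₂ v₂ α₂ o hp₂ hv₂ h20 f₂ hpos
      refine key s₂ v₂ α₂ o hp₂ hv₂ h20 ?_ ?_ ?_ ?_ ?_
      · intro r hr
        have hY : ({10, 11, 12, 13, 20, 21, 22, 23, 24} : Set ℕ) ⊆ X := by
          simp [hX, Set.insert_subset_iff]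
        rw [f₂.reg r (fun h' => hr (hY h')), St.put_reg, St.tick_reg,
          f₁.reg r hr]
      · rw [f₂.reg _ (by simp), St.put_reg, St.tick_reg, r4]
      · intro a ha
        rw [f₂.arr]
        funext x
        rw [St.put_arr, if_neg (by simp [ha]), St.tick_arr, f₁.arr]
      · have t₁ := f₁.time
        have t₂ := f₂.time
        simp only [St.put_time, St.tick_time] at t₂
        omega
      · have t₂ := f₂.qtime
        simp only [St.put_qtime, St.tick_qtime] at t₂
        omega
  -- An empty range contains no hit, so the answer is certainly correct and the search is skipped.
  · have hd0 : d = 0 := by omega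
    have hno : ¬ ∃ x, hit mat O (s.arr 1) (i + 1) x = true := by
      rintro ⟨x, hx⟩
      have := hd x hx
      omega
    refine key _ v α false hψ (.inr ⟨by simpa using hno, hv.trans ?_⟩) ?_ ?_ ?_ ?_ ?_ ?_
    · refine mul_le_mul_of_nonneg_left ?_ (by positivity)
      have : (0 : ℝ) ≤ (3 / 4) ^ w := by positivity
      nlinarith
    · simp [St.set_reg, r20]
    · intro r hr
      rw [St.set_reg, if_neg (by rintro rfl; simp [hX] at hr), St.tick_reg, f₁.reg r hr]
    · simp [St.set_reg, r4]
    · intro a _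
      rw [St.set_arr, St.tick_arr, f₁.arr]
    · have t₁ := f₁.time
      simp only [St.set_time, St.tick_time]
      omega
    · simp only [St.set_qtime, St.tick_qtime, q₁]
      omega

/-! ### Initialisation -/

/-- Set the constants; the word length is five times the bit length of `R[0]`. -/
def init : Prog 4 :=
  .seq (.const 1 1) (.seq (.const 7 2) (.seq (.const 8 4) (.seq (.const 9 5)
    (.seq (.op .add 12 0 6) (.seq (.loop 12 (.seq (.op .div 12 12 7) (.op .add 2 2 9)))
      (.seq (.store 3 6 1) (.op .add 3 0 6)))))))

theorem size_div_two {n : ℕ} (hn : n ≠ 0) : Nat.size (n / 2) + 1 = Nat.size n := by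
  refine eq_of_forall_ge_iff fun k => ?_
  cases k with
  | zero => simpa [Nat.size_eq_zero] using hn
  | succ k =>
    rw [Nat.add_le_add_iff_right, Nat.size_le, Nat.size_le, pow_succ]
    omega

theorem wp_init {n : ℕ} (hw : w = 5 * Nat.size n) (hn : 8 * n < 2 ^ w) (hn2 : 2 ≤ n)
    (h0 : s.reg 0 = n) (hr : ∀ r, r ≠ 0 → s.reg r = 0) (h3 : ∀ x, s.arr 3 x = 0)
    (hΦ : ∀ s', Consts n w s' → s'.reg 3 = n → s'.psi = s.psi → (∀ a, a ≠ 3 → s'.arr a = s.arr a) →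
      s'.time ≤ s.time + 2 * w → s'.qtime = s.qtime → Φ s' v) :
    Wp O init s v Φ := by
  have hsz : 2 ≤ Nat.size n := Nat.lt_size.2 (by simpa using hn2)
  have h5 : 5 < 2 ^ w := by omega
  have hww : w < 2 ^ w := Nat.lt_two_pow_self
  have m1 : 1 % 2 ^ w = 1 := Nat.mod_eq_of_lt (by omega)
  have m2 : 2 % 2 ^ w = 2 := Nat.mod_eq_of_lt (by omega)
  have m4 : 4 % 2 ^ w = 4 := Nat.mod_eq_of_lt (by omega)
  have m5 : 5 % 2 ^ w = 5 := Nat.mod_eq_of_lt (by omega)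
  have mn : n % 2 ^ w = n := Nat.mod_eq_of_lt (by omega)
  refine wp_seq (wp_const (wp_seq (wp_const (wp_seq (wp_const (wp_seq (wp_const (wp_seq
    (wp_op (wp_seq ?_))))))))))
  -- Halving register `12` removes one bit and adds `5` to register `2`, so `R[2] + 5 * Nat.size
  -- R[12]` stays equal to the word length.
  refine wp_loop (fun s' v' => v' = v ∧ s'.reg 0 = n ∧ s'.reg 1 = 1 ∧ s'.reg 6 = 0 ∧
    s'.reg 7 = 2 ∧ s'.reg 8 = 4 ∧ s'.reg 9 = 5 ∧ s'.reg 2 + 5 * Nat.size (s'.reg 12) = w ∧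
    s'.reg 12 ≤ n ∧
    s'.psi = s.psi ∧ s'.arr = s.arr ∧ s'.time + 3 * Nat.size (s'.reg 12) ≤
      s.time + 5 + 3 * Nat.size n ∧ s'.qtime = s.qtime) (fun s' => s'.reg 12) ?_ ?_ ?_
  · rintro s' v' ⟨rfl, r0, r1, r6, r7, r8, r9, r2, -, hp, ha, ht, hq⟩ hx
    rw [hx, Nat.size_zero] at r2 ht
    refine wp_seq (wp_store (wp_op (hΦ _ ⟨?_, ?_, ?_, ?_, ?_, ?_, ?_⟩ ?_ hp ?_ ?_ hq)))
    · simp [St.set_reg, r0]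
    · simp [St.set_reg, r1]
    · simp [St.set_reg]; omega
    · simp [St.set_reg, r6]
    · simp [St.set_reg, r8]
    · simp [St.put_arr, r6, r1]
    · intro x hx
      simp [St.put_arr, r6, hx, ha, h3]
    · simp [St.set_reg, BinOp.eval, r0, r6, mn]
    · intro a h
      funext x
      simp [St.put_arr, h, ha]
    · simp only [St.set_time, St.put_time, St.tick_time]
      omega
  · rintro s' v' ⟨rfl, r0, r1, r6, r7, r8, r9, r2, r12, hp, ha, ht, hq⟩ hx
    have hs := size_div_two hx
    have hlt : s'.reg 12 / 2 < s'.reg 12 := Nat.div_lt_self (by omega) (by norm_num)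
    have hm : s'.reg 12 / 2 % 2 ^ w = s'.reg 12 / 2 := Nat.mod_eq_of_lt (by omega)
    have hm' : (s'.reg 2 + 5) % 2 ^ w = s'.reg 2 + 5 := Nat.mod_eq_of_lt (by omega)
    refine wp_seq (wp_op (wp_op ?_))
    simp only [St.set_reg, St.tick_reg, BinOp.eval, r0, r1, r6, r7, r8, r9, St.set_psi, St.set_arr,
      St.set_time, St.set_qtime, St.tick_time, St.tick_qtime, St.tick_psi, St.tick_arr, hp, ha, hq,
      hm]
    norm_num
    rw [hm']
    omega
  · simp only [St.set_reg, BinOp.eval, h0, St.set_psi, St.set_arr, St.set_time, St.set_qtime, m1,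
      m2, m4, m5, hr 6 (by norm_num), hr 2 (by norm_num)]
    norm_num
    simp only [mn]
    omega

def code (mat : Bool) : Prog 4 := .seq init (.down 3 1 (vertex mat))

/-- The quantum algorithm for maximal independent sets, in the adjacency matrix model if `mat`
holds and otherwise in the adjacency list model. -/
def algorithm (mat : Bool) : Algorithm := ⟨4, 5, by norm_num, code mat⟩

/-! ### Correctness of the greedy construction -/

open Classical in
/-- The array that represents a set of vertices. -/
def indicator (mat : Bool) {n : ℕ} (S : Set (Fin n)) (x : ℕ) : ℕ :=
  if ∃ u ∈ S, x = (u : ℕ) + 1 then (if mat then x else 1) else 0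

theorem indicator_le {mat : Bool} {n : ℕ} (hn : 2 ≤ n) (S : Set (Fin n)) (x : ℕ) :
    indicator mat S x ≤ n := by
  rw [indicator]
  split_ifs with h
  · obtain ⟨u, -, rfl⟩ := h
    exact u.2
  · omega
  · omega

/-- `S` is a maximal independent set among the vertices with numbers at least `i`. -/
structure Partial {n : ℕ} (G : SimpleGraph (Fin n)) (i : ℕ) (S : Set (Fin n)) : Prop where
  indep : ∀ u ∈ S, ∀ v ∈ S, ¬ G.Adj u v
  dominating : ∀ u : Fin n, i ≤ u → u ∉ S → ∃ v ∈ S, G.Adj u v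

/-- A vertex outside `S` is adjacent to a member of `S` and thus lies in no independent superset. -/
theorem Partial.maximal {n : ℕ} {G : SimpleGraph (Fin n)} {S : Set (Fin n)}
    (h : Partial G 0 S) : Maximal G.IsIndepSet S := by
  refine ⟨fun u hu v hv _ => h.indep u hu v hv, fun T hT hST u hu => ?_⟩
  by_contra huS
  obtain ⟨v, hv, huv⟩ := h.dominating u (Nat.zero_le _) huS
  exact hT hu (hST hv) huv.ne huv

theorem Partial.step {n : ℕ} {G : SimpleGraph (Fin n)} {S : Set (Fin n)} {u : Fin n}
    (h : Partial G (u + 1) S) :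
    ((∃ v ∈ S, G.Adj u v) → Partial G u S) ∧
      ((¬ ∃ v ∈ S, G.Adj u v) → Partial G u (insert u S)) := by
  constructor
  · intro hu
    refine ⟨h.indep, fun x hx hxS => ?_⟩
    rcases Nat.eq_or_lt_of_le hx with hx | hx
    · obtain rfl : u = x := Fin.ext hx
      exact hu
    · exact h.dominating x hx hxS
  · intro hu
    push Not at hu
    refine ⟨?_, fun x hx hxS => ?_⟩
    · rintro x (rfl | hx) y (rfl | hy)
      · exact G.loopless.irrefl _
      · exact hu y hy
      · exact fun hxy => hu x hx hxy.symm
      · exact h.indep x hx y hy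
    · rcases Nat.eq_or_lt_of_le hx with hx | hx
      · obtain rfl : u = x := Fin.ext hx
        exact absurd (Set.mem_insert _ _) hxS
      · obtain ⟨y, hy, hxy⟩ := h.dominating x hx fun h' => hxS (Set.mem_insert_of_mem _ h')
        exact ⟨y, Set.mem_insert_of_mem _ hy, hxy⟩

theorem indicator_insert {mat : Bool} {n : ℕ} (S : Set (Fin n)) (u : Fin n) (x : ℕ) :
    indicator mat (insert u S) x =
      if x = u + 1 then (if mat then (u : ℕ) + 1 else 1) else indicator mat S x := by
  by_cases hx : x = u + 1
  · subst hx
    rw [indicator, if_pos ⟨u, Set.mem_insert _ _, rfl⟩, if_pos rfl]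
  · rw [if_neg hx, indicator, indicator]
    congr 1
    refine propext ⟨?_, ?_⟩
    · rintro ⟨y, rfl | hy, hxy⟩
      · exact absurd hxy hx
      · exact ⟨y, hy, hxy⟩
    · rintro ⟨y, hy, hxy⟩
      exact ⟨y, Set.mem_insert_of_mem _ hy, hxy⟩

theorem output_eq {mat : Bool} {n : ℕ} {S : Set (Fin n)} {c : Cfg 4 w}
    (h : ∀ x, c.arr 1 x = indicator mat S x) : c.output n = S := by
  ext u
  change c.arr 1 (u + 1) ≠ 0 ↔ u ∈ S
  rw [h, indicator]
  constructor
  · intro h'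
    by_contra hu
    refine h' (if_neg ?_)
    rintro ⟨y, hy, hxy⟩
    obtain rfl : u = y := Fin.ext (by omega)
    exact hu hy
  · intro hu
    rw [if_pos ⟨u, hu, rfl⟩]
    -- Both encodings are nonzero on members, since vertex numbers start at `1`.
    split_ifs <;> simp

/-- What the correctness proof needs to know about the presentation of a graph. -/
structure Presents (mat : Bool) {n : ℕ} (G : SimpleGraph (Fin n)) (I : Input) (D : ℕ → ℕ) :
    Prop where
  oracle_le : ∀ i j, I.oracle i j ≤ n
  degree_eq : ∀ i, i < n → (if mat then n else I.given (i + 1)) = D i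
  degree_le : ∀ i, i < n → D i ≤ n
  hit_range : ∀ (S : Set (Fin n)) (u : Fin n) (x : ℕ),
    hit mat I.oracle (indicator mat S) (u + 1) x = true → 1 ≤ x ∧ x ≤ D u
  exists_hit : ∀ (S : Set (Fin n)) (u : Fin n),
    (∃ x, hit mat I.oracle (indicator mat S) (u + 1) x = true) ↔ ∃ v ∈ S, G.Adj u v

theorem wp_main {mat : Bool} {n : ℕ} {G : SimpleGraph (Fin n)} {I : Input} {D : ℕ → ℕ}
    (hI : Presents mat G I D) (hw : 10 ≤ w) (hn2 : 2 ≤ n) (hn : 8 * n < 2 ^ w)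
    (hc : Consts n w s) (h3 : s.reg 3 = n) (h1 : ∀ x, s.arr 1 x = 0) (h0 : s.arr 0 = I.given)
    (hψ : s.psi = zeroState) (hv : v ≤ (1 - (3 / 4) ^ w) ^ n)
    (hΦ : ∀ s' v' S, (∀ x, s'.arr 1 x = indicator mat S x) →
      (v' ≤ 0 ∨ Partial G 0 S ∧ v' ≤ normSq s'.psi) →
      s'.time ≤ s.time + (9 * n + 1 + ∑ i ∈ Finset.range n, searchCost w (D i)) →
      s'.qtime ≤ s.qtime + ∑ i ∈ Finset.range n, searchCost w (D i) → Φ s' v') :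
    Wp I.oracle (.down 3 1 (vertex mat)) s v Φ := by
  have hε : (0 : ℝ) ≤ 1 - (3 / 4) ^ w :=
    sub_nonneg.2 (pow_le_one₀ (by norm_num) (by norm_num))
  -- Each vertex still to be processed contributes a factor `1 - (3/4) ^ w` to the weight. Its `9`
  -- classical operations are `7` in the body, the loop test and the decrement. After an error the
  -- weight is at most `0` and nothing is claimed about maximality.
  refine wp_down (fun i s' v' => i ≤ n ∧ ∃ (α : ℂ) (S : Set (Fin n)),
    s'.psi = α • zeroState ∧ Consts n w s' ∧ s'.arr 0 = I.given ∧
    (∀ x, s'.arr 1 x = indicator mat S x) ∧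
    (v' ≤ 0 ∨ Partial G i S ∧ v' ≤ ‖α‖ ^ 2 * (1 - (3 / 4) ^ w) ^ i) ∧
    s'.time + (9 * i + ∑ j ∈ Finset.range i, searchCost w (D j)) ≤
      s.time + (9 * n + ∑ j ∈ Finset.range n, searchCost w (D j)) ∧
    s'.qtime + ∑ j ∈ Finset.range i, searchCost w (D j) ≤
      s.qtime + ∑ j ∈ Finset.range n, searchCost w (D j)) ?_ ?_ (by omega) ?_
  · rintro s' v' ⟨-, α, S, hp, hc', ha0, ha1, hv', ht, hq⟩ hx
    refine hΦ _ v' S ha1 (hv'.imp id fun h => ⟨h.1, ?_⟩) ?_ ?_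
    · rw [St.tick_psi, hp, zeroState_eq_ket, normSq_smul_ket]
      simpa using h.2
    · simp only [St.tick_time]
      simp at ht
      omega
    · simp only [St.tick_qtime]
      simp at hq
      omega
  · rintro i s' v' ⟨hin, α, S, hp, hc', ha0, ha1, hv', ht, hq⟩ hx hi
    refine ⟨hc'.r1, ?_⟩
    have hin' : i < n := hin
    set u : Fin n := ⟨i, hin'⟩ with hu
    have hc₁ : Consts n w (s'.tick.set 3 i) := by
      refine ⟨?_, ?_, ?_, ?_, ?_, hc'.a0, hc'.a1⟩
      · simp [St.set_reg, hc'.r0]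
      · simp [St.set_reg, hc'.r1]
      · simp [St.set_reg, hc'.r2]
      · simp [St.set_reg, hc'.r6]
      · simp [St.set_reg, hc'.r8]
    have ha1' : (s'.tick.set 3 i).arr 1 = indicator mat S := funext ha1
    have hr3 : (s'.tick.set 3 i).reg 3 = i := by
      rw [St.set_reg, if_pos rfl, Nat.mod_eq_of_lt hi]
    -- One factor is spent on the current vertex and `K` is what must remain afterwards. On an
    -- erroneous branch `K = 0` is chosen, which keeps its weight at most `0`.
    obtain ⟨K, hK, hvK, hKv⟩ : ∃ K : ℝ, 0 ≤ K ∧ v' ≤ ‖α‖ ^ 2 * (K * (1 - (3 / 4) ^ w)) ∧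
        (K = 0 ∨ Partial G (i + 1) S ∧ K = (1 - (3 / 4) ^ w) ^ i) := by
      rcases hv' with h | ⟨hP, h⟩
      · exact ⟨0, le_rfl, by simpa using h, .inl rfl⟩
      · exact ⟨_, pow_nonneg hε i, by rwa [← pow_succ], .inr ⟨hP, rfl⟩⟩
    refine wp_vertex hw hc₁ hr3 hin' hn (fun a b => (hI.oracle_le a b).trans_lt (by omega)) ?_
      (d := D i) ?_ (hI.degree_le i hin') ?_ α hp hK hvK ?_
    · intro x
      rw [ha1']
      exact (indicator_le hn2 S x).trans_lt (by omega)
    · rw [← hI.degree_eq i hin', St.set_arr, St.tick_arr, ha0]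
    · rw [ha1']
      exact hI.hit_range S u
    · intro s₂ v₂ α₂ o hp₂ hv₂ hc₂ hr₂ ha₂ hb₂ ht₂ hq₂
      rw [ha1'] at hv₂ hb₂
      rw [show i + 1 = (u : ℕ) + 1 from rfl, hI.exists_hit S u] at hv₂
      simp only [St.set_time, St.tick_time] at ht₂
      simp only [St.set_qtime, St.tick_qtime] at hq₂
      rw [Finset.sum_range_succ] at ht hq
      refine ⟨⟨hin'.le, α₂, if o then S else insert u S, hp₂, hc₂, ha₂.trans ha0, ?_, ?_, by omega,
        by omega⟩, hr₂⟩
      · intro x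
        rw [hb₂]
        cases o
        · simp [indicator_insert, hu]
        · simp
      · rcases hv₂ with h | ⟨ho, h⟩
        · exact .inl h
        rcases hKv with hK0 | ⟨hP, hKi⟩
        · left
          simpa [hK0] using h
        · right
          rw [hKi] at h
          refine ⟨?_, h⟩
          cases o
          · exact (Partial.step (u := u) hP).2 (by simpa using ho)
          · exact (Partial.step (u := u) hP).1 (ho.1 rfl)
  · rw [h3]
    refine ⟨le_rfl, 1, ∅, by simpa using hψ, hc, h0, ?_, .inr ⟨⟨by simp, ?_⟩, by simpa using hv⟩,
      le_rfl, le_rfl⟩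
    · intro x
      simp [h1, indicator]
    · intro u hu
      exact absurd u.2 (by omega)

/-! ### Word length, success probability, and the combined guarantee -/

theorem size_bounds {n : ℕ} (hn : 2 ≤ n) :
    10 ≤ 5 * Nat.size n ∧ 8 * n < 2 ^ (5 * Nat.size n) := by
  have h2 : 2 ≤ Nat.size n := Nat.lt_size.2 (by simpa using hn)
  have h3 : n < 2 ^ Nat.size n := Nat.lt_size_self n
  refine ⟨by omega, ?_⟩
  calc 8 * n < 2 ^ (4 * 2) * 2 ^ Nat.size n := by omega
    _ ≤ 2 ^ (4 * Nat.size n) * 2 ^ Nat.size n :=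
      Nat.mul_le_mul_right _ (Nat.pow_le_pow_right (by norm_num) (by omega))
    _ = _ := by rw [← pow_add]; congr 1; ring

/-- The factor `5` in the word length is chosen because `(3/4) ^ 5 ≤ 1/4`: each search then fails
with probability at most `(1/4) ^ Nat.size n ≤ 1 / n ^ 2`. Bernoulli's inequality handles the `n`-th
power. -/
theorem success_bound {n : ℕ} (hn : 2 ≤ n) :
    1 - 1 / (n : ℝ) ≤ (1 - (3 / 4) ^ (5 * Nat.size n)) ^ n := by
  have hn0 : (0 : ℝ) < n := by positivity
  have h1 : ((3 : ℝ) / 4) ^ (5 * Nat.size n) ≤ 1 / (n : ℝ) ^ 2 := by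
    have h3 : (n : ℝ) ≤ 2 ^ Nat.size n := by exact_mod_cast (Nat.lt_size_self n).le
    calc ((3 : ℝ) / 4) ^ (5 * Nat.size n) = ((3 / 4) ^ 5) ^ Nat.size n := pow_mul _ _ _
      _ ≤ (1 / 4) ^ Nat.size n := pow_le_pow_left₀ (by norm_num) (by norm_num) _
      _ = 1 / (2 ^ Nat.size n) ^ 2 := by
        rw [← pow_mul, mul_comm, pow_mul, div_pow, one_pow]; norm_num
      _ ≤ _ := one_div_le_one_div_of_le (by positivity) (pow_le_pow_left₀ hn0.le h3 2)
  set ε := ((3 : ℝ) / 4) ^ (5 * Nat.size n)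
  have h0 : 0 ≤ ε := by positivity
  have hε : ε ≤ 1 := h1.trans (by
    rw [div_le_one (by positivity)]
    have : (1 : ℝ) ≤ n := by exact_mod_cast (by omega : 1 ≤ n)
    nlinarith)
  have hb := one_add_mul_le_pow (a := -ε) (by linarith) n
  have h2 : n * ε ≤ 1 / n := by
    calc n * ε ≤ n * (1 / (n : ℝ) ^ 2) := mul_le_mul_of_nonneg_left h1 hn0.le
      _ = 1 / n := by field_simp
  calc 1 - 1 / (n : ℝ) ≤ 1 + n * -ε := by linarith
    _ ≤ (1 + -ε) ^ n := hb
    _ = _ := by rw [← sub_eq_add_neg]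

theorem solves {mat : Bool} {n : ℕ} {G : SimpleGraph (Fin n)} {I : Input} {D : ℕ → ℕ}
    (hI : Presents mat G I D) (hn : 2 ≤ n) {t q : ℝ}
    (ht : ((2 * (5 * Nat.size n) + (9 * n + 1 +
      ∑ i ∈ Finset.range n, searchCost (5 * Nat.size n) (D i)) : ℕ) : ℝ) ≤ t)
    (hq : ((∑ i ∈ Finset.range n, searchCost (5 * Nat.size n) (D i) : ℕ) : ℝ) ≤ q) :
    (algorithm mat).Solves n I (fun S => Maximal G.IsIndepSet S) (1 - 1 / (n : ℝ)) t q := by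
  classical
  obtain ⟨hw, hnw⟩ := size_bounds hn
  have hlen : (algorithm mat).wordLength n = 5 * Nat.size n := rfl
  set w := (algorithm mat).wordLength n with hwdef
  rw [← hlen] at hw hnw ht hq
  set s₀ : St 4 w := ⟨Function.update (fun _ => 0) 0 n,
    Function.update (fun _ _ => 0) 0 I.given, zeroState, 0, 0⟩ with hs₀
  have H : Wp I.oracle (code mat) s₀ (1 - 1 / (n : ℝ)) fun s' v' =>
      ((s'.time : ℝ) ≤ t ∧ (s'.qtime : ℝ) ≤ q) ∧
      v' ≤ if Maximal G.IsIndepSet ((s'.cfg []).output n) then normSq s'.psi else 0 := by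
    refine wp_seq (wp_init (n := n) hlen hnw hn (by simp [hs₀]) (fun r hr => by simp [hs₀, hr])
      (by simp [hs₀]) ?_)
    intro s₁ hc₁ h3 hp₁ ha₁ ht₁ hq₁
    refine wp_main hI hw hn hnw hc₁ h3 ?_ ?_ hp₁ ((success_bound hn).trans_eq (by rw [hlen])) ?_
    · intro x
      rw [ha₁ 1 (by norm_num)]
      simp [hs₀]
    · rw [ha₁ 0 (by norm_num)]
      simp [hs₀]
    · intro s₂ v₂ S hS hv₂ ht₂ hq₂
      have e1 : s₀.time = 0 := rfl
      have e2 : s₀.qtime = 0 := rfl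
      refine ⟨⟨le_trans (Nat.cast_le.2 (by omega)) ht, le_trans (Nat.cast_le.2 (by omega)) hq⟩, ?_⟩
      rw [output_eq (c := s₂.cfg []) hS]
      rcases hv₂ with h | ⟨hP, h⟩
      · refine h.trans ?_
        split_ifs
        · exact normSq_nonneg _
        · exact le_rfl
      · rwa [if_pos hP.maximal]
  obtain ⟨N, hN⟩ := (H []).runs
    (A := fun c => (c.time : ℝ) ≤ t ∧ (c.qtime : ℝ) ≤ q)
    (f := fun c => if Maximal G.IsIndepSet (c.output n) then normSq c.psi else 0)
    (fun c => by split_ifs; exacts [normSq_nonneg _, le_rfl]) (fun s v h => h)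
  exact ⟨N, hN N le_rfl⟩

/-! ### The two input models -/

theorem presents_matrix {n : ℕ} (G : SimpleGraph (Fin n)) :
    Presents true G (matrixInput G) fun _ => n := by
  have key : ∀ (S : Set (Fin n)) (u : Fin n) (x : ℕ),
      hit true (matrixInput G).oracle (indicator true S) (u + 1) x = true ↔
        ∃ v ∈ S, x = (v : ℕ) + 1 ∧ G.Adj u v := by
    intro S u x
    simp only [hit, matrixInput, indicator, if_true]
    by_cases h₁ : ∃ u ∈ S, x = (u : ℕ) + 1
    · rw [if_pos h₁]
      split_ifs with h₂
      · refine iff_of_true (by decide) ?_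
        obtain ⟨v, hv, rfl⟩ := h₁
        obtain ⟨a, b, ha, hb, hab⟩ := h₂
        obtain rfl : u = a := Fin.ext (by omega)
        obtain rfl : v = b := Fin.ext (by omega)
        exact ⟨v, hv, rfl, hab⟩
      · refine iff_of_false (by simp) ?_
        rintro ⟨v, hv, rfl, hab⟩
        exact h₂ ⟨u, v, rfl, rfl, hab⟩
    -- For an `x` outside `S` the matrix is queried at column `0`, where it is extended by zero.
    · rw [if_neg h₁, if_neg (by rintro ⟨a, b, -, hb, -⟩; omega)]
      refine iff_of_false (by simp) ?_
      rintro ⟨v, hv, rfl, hab⟩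
      exact h₁ ⟨v, hv, rfl⟩
  refine ⟨fun i j => ?_, fun i _ => rfl, fun _ _ => le_rfl, fun S u x h => ?_, fun S u => ?_⟩
  · simp only [matrixInput]
    split_ifs with h
    · obtain ⟨u, -⟩ := h
      have := u.2
      omega
    · exact Nat.zero_le _
  · obtain ⟨v, -, rfl, -⟩ := (key S u x).1 h
    have := v.2
    omega
  · simp only [key]
    constructor
    · rintro ⟨x, v, hv, -, h⟩
      exact ⟨v, hv, h⟩
    · rintro ⟨v, hv, h⟩
      exact ⟨_, v, hv, rfl, h⟩

theorem listInput_given {n : ℕ} {G : SimpleGraph (Fin n)} [DecidableRel G.Adj] (L : AdjList G)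
    (u : Fin n) : (listInput L).given (u + 1) = G.degree u := by
  simp [listInput]

/-- The default answer `0` is never of the form `v + 1`, so the equation forces `x` to be a valid
position. -/
theorem listInput_oracle {n : ℕ} {G : SimpleGraph (Fin n)} [DecidableRel G.Adj] (L : AdjList G)
    (u v : Fin n) (x : ℕ) :
    (listInput L).oracle (u + 1) x = v + 1 ↔
      ∃ j : Fin (G.degree u), x = j + 1 ∧ (L u j : Fin n) = v := by
  simp only [listInput, Nat.add_sub_cancel, Nat.le_add_left, true_and, u.2, dite_true]
  constructor
  · intro h
    split_ifs at h with hx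
    exact ⟨⟨x - 1, hx.2⟩, by simp only; omega, Fin.ext (by simpa using h)⟩
  · rintro ⟨j, rfl, rfl⟩
    simp

theorem presents_list {n : ℕ} {G : SimpleGraph (Fin n)} [DecidableRel G.Adj] (L : AdjList G) :
    Presents false G (listInput L) fun i => (listInput L).given (i + 1) := by
  have key : ∀ (S : Set (Fin n)) (u : Fin n) (x : ℕ),
      hit false (listInput L).oracle (indicator false S) (u + 1) x = true ↔
        ∃ v ∈ S, ∃ j : Fin (G.degree u), x = j + 1 ∧ (L u j : Fin n) = v := by
    intro S u x
    simp only [hit, indicator, Bool.false_eq_true, if_false]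
    simp only [← listInput_oracle]
    split_ifs with h
    · exact iff_of_true (by decide) h
    · exact iff_of_false (by simp) h
  refine ⟨fun i j => ?_, fun i _ => rfl, fun i hi => ?_, fun S u x h => ?_, fun S u => ?_⟩
  · simp only [listInput]
    split_ifs
    · exact Fin.is_lt _
    · exact Nat.zero_le _
    · exact Nat.zero_le _
  · rw [listInput_given L ⟨i, hi⟩]
    exact (G.degree_lt_card_verts _).le.trans_eq (Fintype.card_fin n)
  · obtain ⟨v, -, j, rfl, -⟩ := (key S u x).1 h
    rw [listInput_given]
    have := j.2
    omega
  · simp only [key]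
    constructor
    · rintro ⟨x, v, hv, j, -, rfl⟩
      exact ⟨_, hv, (L u j).2⟩
    · rintro ⟨v, hv, h⟩
      obtain ⟨j, hj⟩ := (L u).surjective ⟨v, h⟩
      exact ⟨_, v, hv, j, rfl, by rw [hj]⟩

/-! ### Asymptotic bounds -/

theorem log_ge {n : ℕ} (hn : 2 ≤ n) : 0.69 ≤ Real.log n := by
  have h1 : Real.log 2 ≤ Real.log n := Real.log_le_log (by norm_num) (by exact_mod_cast hn)
  have := Real.log_two_gt_d9
  linarith

/-- As `Nat.size n - 1 ≤ log n / log 2` and `log 2 ≤ log n`, the bit length is at most `2 * log n /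
log 2 ≤ 3 * log n`. -/
theorem size_le_log {n : ℕ} (hn : 2 ≤ n) : ((5 * Nat.size n : ℕ) : ℝ) ≤ 15 * Real.log n := by
  have h0 : 0 < Nat.size n := Nat.size_pos.2 (by omega)
  have h1 : 2 ^ (Nat.size n - 1) ≤ n := Nat.lt_size.1 (by omega)
  have h2 : ((Nat.size n - 1 : ℕ) : ℝ) * Real.log 2 ≤ Real.log n := by
    rw [← Real.log_pow]
    exact Real.log_le_log (by positivity) (by exact_mod_cast h1)
  have h3 : Real.log 2 ≤ Real.log n := Real.log_le_log (by norm_num) (by exact_mod_cast hn)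
  have := Real.log_two_gt_d9
  rw [Nat.cast_sub h0] at h2
  push_cast at h2 ⊢
  nlinarith

theorem searchCost_le {n : ℕ} (hn : 2 ≤ n) (d : ℕ) :
    (searchCost (5 * Nat.size n) d : ℝ) ≤ 9000 * (√(8 * d) * Real.log n ^ 2) := by
  have h1 : (Nat.sqrt (8 * d) : ℝ) ≤ √(8 * d) := by
    have := Real.nat_sqrt_le_real_sqrt (a := 8 * d)
    push_cast at this
    exact this
  have h2 : ((5 * Nat.size n : ℕ) : ℝ) ^ 2 ≤ (15 * Real.log n) ^ 2 :=
    pow_le_pow_left₀ (by positivity) (size_le_log hn) 2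
  rw [searchCost, Nat.cast_mul, Nat.cast_mul, Nat.cast_pow]
  -- The constant is `9000 = 40 * 15 ^ 2`.
  calc ((40 : ℕ) : ℝ) * (Nat.sqrt (8 * d) * ((5 * Nat.size n : ℕ) : ℝ) ^ 2)
      ≤ 40 * (√(8 * d) * (15 * Real.log n) ^ 2) := by
        push_cast at h2 ⊢
        gcongr
    _ = _ := by ring

/-- The Cauchy–Schwarz inequality turns the sum of the roots into the root of `n` times the sum. -/
theorem sum_searchCost_le {n : ℕ} (hn : 2 ≤ n) (D : ℕ → ℕ) :
    ((∑ i ∈ Finset.range n, searchCost (5 * Nat.size n) (D i) : ℕ) : ℝ) ≤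
      9000 * (√(8 * (n * ∑ i ∈ Finset.range n, (D i : ℝ))) * Real.log n ^ 2) := by
  have h1 : ∑ i ∈ Finset.range n, √(8 * (D i : ℝ)) ≤
      √(8 * (n * ∑ i ∈ Finset.range n, (D i : ℝ))) := by
    refine Real.le_sqrt_of_sq_le ((sq_sum_le_card_mul_sum_sq ..).trans_eq ?_)
    rw [Finset.card_range, Finset.sum_congr rfl fun i _ => Real.sq_sqrt (by positivity),
      ← Finset.mul_sum]
    ring
  calc ((∑ i ∈ Finset.range n, searchCost (5 * Nat.size n) (D i) : ℕ) : ℝ)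
      ≤ ∑ i ∈ Finset.range n, 9000 * (√(8 * D i) * Real.log n ^ 2) := by
        push_cast
        exact Finset.sum_le_sum fun i _ => searchCost_le hn _
    _ = 9000 * ((∑ i ∈ Finset.range n, √(8 * (D i : ℝ))) * Real.log n ^ 2) := by
        rw [Finset.sum_mul, Finset.mul_sum]
    _ ≤ _ := by gcongr

theorem setup_cost_le {n : ℕ} (hn : 2 ≤ n) :
    2 * ((5 * Nat.size n : ℕ) : ℝ) + 9 * n + 1 ≤ 100 * (n * Real.log n ^ 2) := by
  have h1 := size_le_log hn
  have h2 := log_ge hn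
  have h3 : (2 : ℝ) ≤ n := by exact_mod_cast hn
  have h4 : (0.47 : ℝ) ≤ Real.log n ^ 2 := by nlinarith
  have h5 : Real.log n ≤ 1.5 * Real.log n ^ 2 := by nlinarith
  have h6 : 2 * Real.log n ^ 2 ≤ n * Real.log n ^ 2 := by nlinarith
  have h7 : 0.47 * n ≤ n * Real.log n ^ 2 := by nlinarith
  nlinarith

end Mis

open Mis

theorem solves_matrix {n : ℕ} (hn : 2 ≤ n) (G : SimpleGraph (Fin n)) :
    (algorithm true).Solves n (matrixInput G) (fun S => Maximal G.IsIndepSet S)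
      (1 - 1 / (n : ℝ)) (40000 * (n : ℝ) ^ (1.5 : ℝ) * Real.log n ^ 2)
      (40000 * (n : ℝ) ^ (1.5 : ℝ) * Real.log n ^ 2) := by
  have hn1 : (1 : ℝ) ≤ n := by exact_mod_cast (by omega : 1 ≤ n)
  have hs1 : 1 ≤ √(n : ℝ) := Real.one_le_sqrt.2 hn1
  have hpow : (n : ℝ) ^ (1.5 : ℝ) = n * √n := by
    rw [show (1.5 : ℝ) = 1 + 1 / 2 by norm_num, Real.rpow_add (by linarith), Real.rpow_one,
      Real.sqrt_eq_rpow]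
  have h1 := sum_searchCost_le hn fun _ => n
  have h2 := setup_cost_le hn
  have h3 : √(8 * ((n : ℝ) * ∑ _i ∈ Finset.range n, (n : ℝ))) ≤ 3 * (n * √n) := by
    rw [Finset.sum_const, Finset.card_range, nsmul_eq_mul]
    refine Real.sqrt_le_iff.2 ⟨by positivity, ?_⟩
    rw [mul_pow, mul_pow, Real.sq_sqrt (by linarith)]
    have : (0 : ℝ) ≤ n * (n * n) := by positivity
    nlinarith
  have hlog : 0 ≤ Real.log n ^ 2 := sq_nonneg _
  have h4 := h1.trans (mul_le_mul_of_nonneg_left (mul_le_mul_of_nonneg_right h3 hlog)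
    (by norm_num))
  have h5 : n * Real.log n ^ 2 ≤ n * √n * Real.log n ^ 2 :=
    mul_le_mul_of_nonneg_right (le_mul_of_one_le_right (by linarith) hs1) hlog
  have h6 : 0 ≤ n * √n * Real.log n ^ 2 := by positivity
  rw [hpow]
  refine solves (presents_matrix G) hn ?_ ?_
  · rw [Nat.cast_add, Nat.cast_add]
    push_cast at h4 h2 ⊢
    linarith
  · linarith

theorem solves_list {n : ℕ} (hn : 2 ≤ n) {G : SimpleGraph (Fin n)} [DecidableRel G.Adj]
    (L : AdjList G) :
    (algorithm false).Solves n (listInput L) (fun S => Maximal G.IsIndepSet S)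
      (1 - 1 / (n : ℝ))
      (40000 * ((n : ℝ) + √((n : ℝ) * (G.edgeFinset.card : ℝ))) * Real.log n ^ 2)
      (40000 * √((n : ℝ) * (G.edgeFinset.card : ℝ)) * Real.log n ^ 2) := by
  have h1 := sum_searchCost_le hn fun i => (listInput L).given (i + 1)
  have h2 := setup_cost_le hn
  have hdeg : ∑ i ∈ Finset.range n, (((listInput L).given (i + 1) : ℕ) : ℝ) =
      2 * (G.edgeFinset.card : ℝ) := by
    rw [← Fin.sum_univ_eq_sum_range (fun i => (((listInput L).given (i + 1) : ℕ) : ℝ))]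
    simp only [listInput_given]
    exact_mod_cast G.sum_degrees_eq_twice_card_edges
  -- The degrees sum to `2 * m`, so the bound becomes `9000 * 4 = 36000` times `√(n * m) * log² n`;
  -- the set-up costs fit into the rest of `40000`.
  have h3 : √(8 * ((n : ℝ) * (2 * (G.edgeFinset.card : ℝ)))) =
      4 * √((n : ℝ) * (G.edgeFinset.card : ℝ)) := by
    rw [show 8 * ((n : ℝ) * (2 * (G.edgeFinset.card : ℝ))) =
      4 ^ 2 * ((n : ℝ) * (G.edgeFinset.card : ℝ)) by ring, Real.sqrt_mul (by norm_num),
      Real.sqrt_sq (by norm_num)]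
  rw [hdeg, h3] at h1
  have h4 : 0 ≤ √((n : ℝ) * (G.edgeFinset.card : ℝ)) * Real.log n ^ 2 := by positivity
  have h5 : 0 ≤ n * Real.log n ^ 2 := by positivity
  refine solves (presents_list L) hn ?_ ?_
  · rw [Nat.cast_add, Nat.cast_add]
    push_cast at h1 h2 ⊢
    linarith
  · linarith

end QRam

end

theorem mainTheorem8 :
    (∃ P : QRam.Algorithm, ∃ C : ℝ, 0 < C ∧
      ∀ n : ℕ, 2 ≤ n → ∀ G : SimpleGraph (Fin n),
        P.Solves n (QRam.matrixInput G) (fun S => Maximal G.IsIndepSet S)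
          (1 - 1 / (n : ℝ))
          (C * (n : ℝ) ^ (1.5 : ℝ) * Real.log n ^ 2)
          (C * (n : ℝ) ^ (1.5 : ℝ) * Real.log n ^ 2)) ∧
    (∃ P : QRam.Algorithm, ∃ C : ℝ, 0 < C ∧
      ∀ n : ℕ, 2 ≤ n → ∀ (G : SimpleGraph (Fin n)) [DecidableRel G.Adj] (L : QRam.AdjList G),
        P.Solves n (QRam.listInput L) (fun S => Maximal G.IsIndepSet S)
          (1 - 1 / (n : ℝ))
          (C * ((n : ℝ) + Real.sqrt ((n : ℝ) * (G.edgeFinset.card : ℝ))) * Real.log n ^ 2)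
          (C * Real.sqrt ((n : ℝ) * (G.edgeFinset.card : ℝ)) * Real.log n ^ 2)) :=
  ⟨⟨QRam.Mis.algorithm true, 40000, by norm_num, fun _ hn G => QRam.solves_matrix hn G⟩,
    ⟨QRam.Mis.algorithm false, 40000, by norm_num, fun _ hn _ _ L => QRam.solves_list hn L⟩⟩
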